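/- Let $\Pi=\{z\in\mathbb C:\operatorname{Im} z>0\}$, let $s\ge 0$ be real, and let $\gamma:[0,\infty)\to[0,\infty)$ be a monotone increasing (i.e. non-decreasing) function with $\gamma(t)>0$ for $t>0$ and $\gamma(t)=O(t^{2s+2})$ as $t\to 0$. Let $f:\Pi\to\overline{\Pi}$ be analytic and let $\tau\in\mathbb R$. *Definitions.* The Nevanlinna measure $\mu_f$ is the weak limit (against continuous compactly supported functions) of the measures $\operatorname{Im} f(x+iy)\,dx$ on $\mathbb R$ as $y\downarrow 0$. The function $f$ is *$\gamma$-regular at $\tau$* if there is $C>0$ such that $1/\gamma(C|t-\tau|)$ (read as $\infty$ where the denominator is $0$) is integrable with respect to $\mu_f$ on a neighborhood of $\tau$. A function $\eta:[0,\infty)\to[0,\infty)$ is a *$\gamma$-augury* if $\eta(t)=o(t)$ as $t\to 0$ and there is $C>0$ such that $\dfrac{t\,\eta(Ct)}{\gamma(t)^2}$ is integrable on $[0,1)$ with respect to the measure $d\gamma$, the distributional derivative of $\gamma$; at a discontinuity of $\gamma$ the expression $\gamma(t)^2$ is read as $\gamma(t^-)\gamma(t^+)$, so that $d\gamma/\gamma^2=-d(1/\gamma)$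 on $(0,1)$. The Julia quotient is $J_f(z)=\operatorname{Im} f(z)/\operatorname{Im} z$. For a function on $\Pi$ of the form $u(z)=c+\int_{\mathbb R}|z-t|^{-2r}\,d\sigma(t)$, with $r>0$, $c$ a constant and $\sigma$ a difference of two positive Borel measures each integrating $(1+t^2)^{-r}$, the fractional Laplacian is $$\Delta^s u(z)=\frac{\Gamma(r+s)^2}{\Gamma(r)^2}\int_{\mathbb R}\frac{d\sigma(t)}{|z-t|^{2(r+s)}}$$ (constants are annihilated); $J_f$ is of this form with $r=1$. For $\lambda:[0,\infty)\to[0,\infty)$ and $d>0$ with $\lambda(d)>0$, the fractional Laplacian of the amortized Julia quotient is the average of $\Delta^sJ_f$ over the segment $C_d=\{x+i\lambda(d):|x-\tau|\le d\}$: $$\Delta^s AJ^{\tau}_{f,\lambda}(d)=\frac1{2d}\int_{\tau-d}^{\tau+d}\Delta^sJ_f(x+i\lambda(d))\,dx .$$ **Theorem.** The function $f$ is $\gamma$-regular at $\tau$ if and only if there is a function $\lambda:[0,\infty)\to[0,\infty)$, with $\lambda(t)>0$ for all sufficiently small $t>0$ and $\lambda(t)=o(t)$ as $t\to0$, such that $\lambda^{2s+1}$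 is a $\gamma$-augury and $\Delta^sAJ^{\tau}_{f,\lambda}(d)$ is bounded as $d\downarrow 0$. -/

import Mathlib

open Set Filter Topology MeasureTheory Asymptotics
open scoped NNReal ENNReal

noncomputable section

namespace Pick

/-- `f` is an analytic function from the open upper half plane to its closure. -/
structure IsPick (f : ℂ → ℂ) : Prop where
  analytic : AnalyticOn ℂ f {z : ℂ | 0 < z.im}
  im_nonneg : ∀ z : ℂ, 0 < z.im → 0 ≤ (f z).im

/-- The Julia quotient on the upper half plane: the ratio of the distances of `f z` and of `z`
to the real axis. -/
def juliaQuotient (f : ℂ → ℂ) (z : ℂ) : ℝ := (f z).im / z.im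

/-- `μ` is the weak limit of the measures `Im f (x + i y) dx` as `y` decreases to `0`, tested
against continuous functions of compact support. -/
def IsNevanlinnaMeasure (f : ℂ → ℂ) (μ : Measure ℝ) : Prop :=
  IsLocallyFiniteMeasure μ ∧
    ∀ φ : ℝ → ℝ, Continuous φ → HasCompactSupport φ →
      Tendsto (fun y : ℝ => ∫ x : ℝ, φ x * (f (x + y * Complex.I)).im) (𝓝[>] 0)
        (𝓝 (∫ x, φ x ∂μ))

open Classical in
/-- The Nevanlinna measure of `f` (the zero measure should the weak limit not exist, which does
not occur for functions satisfying `IsPick`). -/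
def nevanlinnaMeasure (f : ℂ → ℂ) : Measure ℝ :=
  if h : ∃ μ, IsNevanlinnaMeasure f μ then h.choose else 0

/-- `γ`-regularity at `τ`: for some `C > 0` the function `1 / γ (C |t - τ|)` (equal to `∞` where
`γ (C |t - τ|) = 0`) is integrable near `τ` against the Nevanlinna measure. -/
def IsRegular (γ : ℝ≥0 → ℝ≥0) (f : ℂ → ℂ) (τ : ℝ) : Prop :=
  ∃ C : ℝ≥0, 0 < C ∧ ∃ U ∈ 𝓝 τ,
    ∫⁻ t in U, ((γ (C * nndist t τ) : ℝ≥0) : ℝ≥0∞)⁻¹ ∂(nevanlinnaMeasure f) < ∞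

/-- The extension of `γ : [0, ∞) → [0, ∞)` to the real line by the constant `γ 0`. -/
def extend (γ : ℝ≥0 → ℝ≥0) (t : ℝ) : ℝ := γ t.toNNReal

theorem extend_monotone {γ : ℝ≥0 → ℝ≥0} (hγ : Monotone γ) : Monotone (extend γ) :=
  fun _ _ h => NNReal.coe_le_coe.2 (hγ (Real.toNNReal_le_toNNReal h))

/-- The distributional derivative of the monotone function `γ`, a positive measure. -/
def derivMeasure (γ : ℝ≥0 → ℝ≥0) (hγ : Monotone γ) : Measure ℝ :=
  (extend_monotone hγ).stieltjesFunction.measure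

/-- `η` is a `γ`-augury: `η t = o(t)` as `t → 0`, and for some `C > 0` the expression
`t η(C t) dγ(t) / γ(t) ^ 2` is integrable on `[0, 1)`.  At a point of discontinuity, `γ(t) ^ 2`
stands for `γ(t-) γ(t+)`, so that `dγ / γ ^ 2 = - d(1 / γ)` for every monotone `γ`; where `γ` is
continuous, the product of the one-sided limits is `γ(t) ^ 2`. -/
def IsAugury (γ : ℝ≥0 → ℝ≥0) (hγ : Monotone γ) (η : ℝ≥0 → ℝ≥0) : Prop :=
  (fun t : ℝ≥0 => (η t : ℝ)) =o[𝓝[>] 0] (fun t : ℝ≥0 => (t : ℝ)) ∧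
  ∃ C : ℝ≥0, 0 < C ∧
    IntegrableOn
      (fun t : ℝ => t * (η (C * t.toNNReal) : ℝ) /
        (Function.leftLim (extend γ) t * Function.rightLim (extend γ) t))
      (Ico 0 1) (derivMeasure γ hγ)

/-- The graph of the fractional Laplacian `Δ ^ s` on the functions `c + ∫ |z - t| ^ (-2 r) dσ(t)`
on the upper half plane, `c` a constant and `σ = μ - ν` a signed measure with
`∫ (1 + t ^ 2) ^ (-r) d|σ| < ∞`: it annihilates the constant and sends the integral to
`(Γ(r + s) / Γ(r)) ^ 2 ∫ |z - t| ^ (-2 (r + s)) dσ(t)`. -/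
def IsFracLaplacian (r s : ℝ) (u v : ℂ → ℝ) : Prop :=
  ∃ (c : ℝ) (μ ν : Measure ℝ),
    Integrable (fun t : ℝ => (1 + t ^ 2) ^ (-r)) μ ∧
    Integrable (fun t : ℝ => (1 + t ^ 2) ^ (-r)) ν ∧
    ∀ z : ℂ, 0 < z.im →
      u z = c + ((∫ t : ℝ, ‖z - t‖ ^ (-2 * r) ∂μ) - ∫ t : ℝ, ‖z - t‖ ^ (-2 * r) ∂ν) ∧
      v z = Real.Gamma (r + s) ^ 2 / Real.Gamma r ^ 2 *
        ((∫ t : ℝ, ‖z - t‖ ^ (-2 * (r + s)) ∂μ) - ∫ t : ℝ, ‖z - t‖ ^ (-2 * (r + s)) ∂ν)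

open Classical in
/-- The fractional Laplacian `Δ ^ s u` on the upper half plane of a function `u` of the form
`c + ∫ |z - t| ^ (-2 r) dσ(t)` (zero for other functions). -/
def fracLaplacian (r s : ℝ) (u : ℂ → ℝ) : ℂ → ℝ :=
  if h : ∃ v, IsFracLaplacian r s u v then h.choose else 0

/-- The average of `u` over the segment `C_d` of points at height `h = lam d` above the real axis
and at horizontal distance at most `d` from `τ`. -/
def amortize (lam : ℝ≥0 → ℝ≥0) (τ : ℝ) (u : ℂ → ℝ) (d : ℝ≥0) : ℝ :=
  (2 * (d : ℝ))⁻¹ * ∫ x in (τ - d)..(τ + d), u ((x : ℂ) + ((lam d : ℝ) : ℂ) * Complex.I)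

/-- The fractional Laplacian of the amortized Julia quotient: the average over `C_d` of the
fractional Laplacian of the Julia quotient (a function of the above form with `r = 1`). -/
def fracLaplacianAJ (s : ℝ) (f : ℂ → ℂ) (lam : ℝ≥0 → ℝ≥0) (τ : ℝ) (d : ℝ≥0) : ℝ :=
  amortize lam τ (fracLaplacian 1 s (juliaQuotient f)) d

end Pick

end

/-! The Nevanlinna representation gives `J_f(z) = a + π⁻¹ ∫ |z - t|⁻² dμ(t)` with `μ` the Nevanlinna
measure, so `Δ^s J_f` is, up to the factor `Γ(1+s)²/π`, the integral of `|z - t|^(-2(1+s))` against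
`μ`. Average this kernel over the segment of half-width `d` at height `l = λ(d)`. For `l ≤ d` and
`|t - τ| ≤ d` its integral in `x` is comparable to `l^(-(2s+1))`; for `|t - τ| > 2d` it is at most a
constant times `d |t - τ|^(-(2s+2))`. Thus a bounded average forces `μ(B(τ,d)) ≤ M d λ(d)^(2s+1)`.
Conversely, such a bound on `B(τ,2d)` together with finiteness of `∫ |t - τ|^(-(2s+2)) dμ` makes the
average bounded.

Regularity is also a statement about ball masses. Since `dγ/γ² = -d(1/γ)`, the number `1/γ(r)` is,
up to a bounded term and a factor 2 in the argument, the `dγ/γ²`-mass of `[r, 1)`. Fubini then turns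
`∫ 1/γ(C|t - τ|) dμ` into `∫ μ(B(τ, cu)) dγ(u)/γ(u)²` (`lintegral_invMass`). This is the augury
integral of `η(d) = μ(B(τ,d))/d`.

Hence an augury `λ^(2s+1)` with bounded average yields regularity. For the converse take `λ^(2s+1)`
to be essentially `μ(B(τ,2d))/d`. The hypothesis `γ = O(t^(2s+2))` enters only here: with regularity
it gives `∫ |t - τ|^(-(2s+2)) dμ < ∞`, which controls the distant mass and yields `μ(B(τ,2d)) =
o(d^(2s+2))`, that is `λ(d) = o(d)`. It also forces `γ(0) = 0`, so that `μ` has no atom at `τ`. -/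

namespace Pick

/-! ### Herglotz representation on the disc -/

/-- The measure on `[0, 2π]` with density `Im g (r e ^ {iθ}) / 2π`. -/
noncomputable def circleMeasure (g : ℂ → ℂ) (r : ℝ) : Measure ℝ :=
  (volume.restrict (Ioc 0 (2 * Real.pi))).withDensity
    fun θ => ENNReal.ofReal ((2 * Real.pi)⁻¹ * (g (r * circleMap 0 1 θ)).im)

theorem mul_circleMap_mem_ball {r : ℝ} (hr : r ∈ Ioo (0 : ℝ) 1) (θ : ℝ) :
    (r : ℂ) * circleMap 0 1 θ ∈ Metric.ball (0 : ℂ) 1 := by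
  simp [circleMap, abs_of_pos hr.1, hr.2]

theorem continuous_im_mul_circleMap {g : ℂ → ℂ} (hg : DifferentiableOn ℂ g (Metric.ball 0 1))
    {r : ℝ} (hr : r ∈ Ioo (0 : ℝ) 1) : Continuous fun θ : ℝ => (g (r * circleMap 0 1 θ)).im := by
  refine Complex.continuous_im.comp (hg.continuousOn.comp_continuous ?_ (mul_circleMap_mem_ball hr))
  exact continuous_const.mul (continuous_circleMap 0 1)

theorem integral_circleMeasure {g : ℂ → ℂ} (hg : DifferentiableOn ℂ g (Metric.ball 0 1))
    (hpos : ∀ w ∈ Metric.ball (0 : ℂ) 1, 0 ≤ (g w).im) {r : ℝ} (hr : r ∈ Ioo (0 : ℝ) 1)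
    (φ : ℝ → ℝ) :
    ∫ θ, φ θ ∂(circleMeasure g r) =
      (2 * Real.pi)⁻¹ * ∫ θ in (0 : ℝ)..2 * Real.pi, φ θ * (g (r * circleMap 0 1 θ)).im := by
  have hm : Measurable fun θ : ℝ => (2 * Real.pi)⁻¹ * (g (r * circleMap 0 1 θ)).im :=
    ((continuous_im_mul_circleMap hg hr).measurable).const_mul _
  rw [circleMeasure, integral_withDensity_eq_integral_toReal_smul hm.ennreal_ofReal (by simp),
    intervalIntegral.integral_of_le Real.two_pi_pos.le, ← integral_const_mul]
  refine integral_congr_ae (Eventually.of_forall fun θ => ?_)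
  have : 0 ≤ (2 * Real.pi)⁻¹ * (g (r * circleMap 0 1 θ)).im :=
    mul_nonneg (by positivity) (hpos _ (mul_circleMap_mem_ball hr θ))
  simp only [ENNReal.toReal_ofReal this, smul_eq_mul]
  ring

theorem continuous_poissonKernel_circleMap {w : ℂ} (hw : w ∈ Metric.ball (0 : ℂ) 1) :
    Continuous fun θ : ℝ => poissonKernel 0 w (circleMap 0 1 θ) := by
  unfold poissonKernel
  refine Continuous.div (by fun_prop) (by fun_prop) fun θ => ?_
  have : circleMap 0 1 θ ≠ w := by
    rintro rfl
    simp [circleMap] at hw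
  simpa [sub_eq_zero] using this

/-- For `r < 1` the dilate `g(r ·)` is analytic across the closed disc, so the Poisson formula
applies to it; take imaginary parts. -/
theorem circleAverage_poissonKernel_mul_im {g : ℂ → ℂ}
    (hg : DifferentiableOn ℂ g (Metric.ball 0 1)) {r : ℝ} (hr : r ∈ Ioo (0 : ℝ) 1) {w : ℂ}
    (hw : w ∈ Metric.ball (0 : ℂ) 1) :
    (2 * Real.pi)⁻¹ * ∫ θ in (0 : ℝ)..2 * Real.pi,
      poissonKernel 0 w (circleMap 0 1 θ) * (g (r * circleMap 0 1 θ)).im = (g (r * w)).im := by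
  have hmaps : MapsTo (fun z : ℂ => (r : ℂ) * z) (Metric.closedBall 0 1) (Metric.ball 0 1) := by
    intro z hz
    simp only [mem_closedBall_zero_iff, mem_ball_zero_iff, norm_mul, Complex.norm_real,
      Real.norm_of_nonneg hr.1.le] at hz ⊢
    nlinarith [hr.1, hr.2, norm_nonneg z]
  have hd : DiffContOnCl ℂ (fun z => g (r * z)) (Metric.ball 0 1) := by
    refine DifferentiableOn.diffContOnCl (hg.comp (by fun_prop) ?_)
    rwa [closure_ball _ one_ne_zero]
  have h := congrArg Complex.im (hd.circleAverage_poissonKernel_smul hw)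
  rw [← h, Real.circleAverage_def, Complex.smul_im, smul_eq_mul]
  congr 1
  have hcont : Continuous fun θ : ℝ =>
      (poissonKernel 0 w • fun z => g (r * z)) (circleMap 0 1 θ) := by
    refine (continuous_poissonKernel_circleMap hw).smul
      (hg.continuousOn.comp_continuous ?_ (mul_circleMap_mem_ball hr))
    exact continuous_const.mul (continuous_circleMap 0 1)
  have := Complex.imCLM.intervalIntegral_comp_comm (hcont.intervalIntegrable (μ := volume) 0
    (2 * Real.pi))
  simp only [Complex.imCLM_apply] at this
  rw [← this]
  refine intervalIntegral.integral_congr fun θ _ => ?_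
  simp

/-- The Poisson kernel at the centre is identically `1`. The mass therefore does not depend on `r`,
which is the bound needed for weak compactness. -/
theorem circleMeasure_univ {g : ℂ → ℂ} (hg : DifferentiableOn ℂ g (Metric.ball 0 1))
    (hpos : ∀ w ∈ Metric.ball (0 : ℂ) 1, 0 ≤ (g w).im) {r : ℝ} (hr : r ∈ Ioo (0 : ℝ) 1) :
    circleMeasure g r univ = ENNReal.ofReal (g 0).im := by
  have h := circleAverage_poissonKernel_mul_im hg hr (Metric.mem_ball_self one_pos)
  rw [← integral_circleMeasure hg hpos hr] at h
  have h1 : ∀ θ : ℝ, poissonKernel 0 0 (circleMap 0 1 θ) = 1 := by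
    simp [poissonKernel, circleMap]
  simp only [h1, mul_zero] at h
  have hfin : IsFiniteMeasure (circleMeasure g r) := by
    constructor
    rw [circleMeasure, withDensity_apply _ MeasurableSet.univ, Measure.restrict_univ]
    have hc : Continuous fun θ : ℝ => (2 * Real.pi)⁻¹ * (g (r * circleMap 0 1 θ)).im :=
      (continuous_im_mul_circleMap hg hr).const_mul _
    have hi : IntegrableOn (fun θ : ℝ => (2 * Real.pi)⁻¹ * (g (r * circleMap 0 1 θ)).im)
        (Ioc 0 (2 * Real.pi)) :=
      (hc.integrableOn_Icc (a := 0) (b := 2 * Real.pi)).mono_set Ioc_subset_Icc_self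
    exact hi.lintegral_lt_top
  rw [integral_const, smul_eq_mul, mul_one] at h
  rw [← h, ofReal_measureReal]

theorem exists_bound_poissonKernel_circleMap {w : ℂ} (hw : w ∈ Metric.ball (0 : ℂ) 1) :
    ∃ C, ∀ θ : ℝ, ‖poissonKernel 0 w (circleMap 0 1 θ)‖ ≤ C := by
  have hper : Function.Periodic (fun θ : ℝ => poissonKernel 0 w (circleMap 0 1 θ))
      (2 * Real.pi) := fun θ => by simp only [periodic_circleMap 0 1 θ]
  obtain ⟨C, hC⟩ := (isCompact_Icc (a := (0 : ℝ)) (b := 0 + 2 * Real.pi)).exists_bound_of_continuousOn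
    (continuous_poissonKernel_circleMap hw).continuousOn
  refine ⟨C, fun θ => ?_⟩
  obtain ⟨y, hy, hxy⟩ := hper.exists_mem_Ico Real.two_pi_pos θ 0
  rw [hxy]
  exact hC y (Ico_subset_Icc_self hy)

/-- The Herglotz representation of the imaginary part of an analytic function on the unit disc. -/
theorem exists_measure_im_eq_integral_poissonKernel {g : ℂ → ℂ}
    (hg : DifferentiableOn ℂ g (Metric.ball 0 1))
    (hpos : ∀ w ∈ Metric.ball (0 : ℂ) 1, 0 ≤ (g w).im) :
    ∃ σ : Measure ℝ, IsFiniteMeasure σ ∧ ∀ w ∈ Metric.ball (0 : ℂ) 1,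
      (g w).im = ∫ θ, poissonKernel 0 w (circleMap 0 1 θ) ∂σ := by
  have hIoo : ∀ᶠ r in 𝓝[<] (1 : ℝ), r ∈ Ioo (0 : ℝ) 1 := Ioo_mem_nhdsLT one_pos
  have hfin : ∀ r, r ∈ Ioo (0 : ℝ) 1 → IsFiniteMeasure (circleMeasure g r) := fun r hr =>
    ⟨by rw [circleMeasure_univ hg hpos hr]; exact ENNReal.ofReal_lt_top⟩
  classical
  let σ : ℝ → FiniteMeasure ℝ := fun r =>
    if h : r ∈ Ioo (0 : ℝ) 1 then ⟨circleMeasure g r, hfin r h⟩ else 0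
  have hσ : ∀ r, r ∈ Ioo (0 : ℝ) 1 → (σ r : Measure ℝ) = circleMeasure g r := by
    intro r hr
    rw [show σ r = ⟨circleMeasure g r, hfin r hr⟩ from dif_pos hr]
    rfl
  -- Along an ultrafilter finer than `r ↑ 1` the measures converge by compactness, with no passage
  -- to a subsequence.
  let F : Ultrafilter ℝ := Ultrafilter.of (𝓝[<] (1 : ℝ))
  have hF : (F : Filter ℝ) ≤ 𝓝[<] (1 : ℝ) := Ultrafilter.of_le _
  have hK := isCompact_setOfPred_finiteMeasure_le_of_isCompact (E := ℝ) (g 0).im.toNNReal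
    (isCompact_Icc (a := (0 : ℝ)) (b := 2 * Real.pi))
  obtain ⟨μ, -, hμ⟩ := hK.ultrafilter_le_nhds (F.map σ) (by
    rw [le_principal_iff, Ultrafilter.coe_map, mem_map]
    refine hF ?_
    filter_upwards [hIoo] with r hr
    have hu : (σ r : Measure ℝ) univ = ENNReal.ofReal (g 0).im := by
      rw [hσ r hr, circleMeasure_univ hg hpos hr]
    refine ⟨?_, ?_⟩
    · rw [← ENNReal.coe_le_coe, FiniteMeasure.ennreal_mass, hu]
      rfl
    · rw [FiniteMeasure.null_iff_toMeasure_null, hσ r hr, circleMeasure]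
      refine withDensity_absolutelyContinuous _ _ ?_
      rw [Measure.restrict_apply measurableSet_Icc.compl]
      convert measure_empty (μ := (volume : Measure ℝ))
      ext x
      simp only [mem_inter_iff, mem_compl_iff, mem_Icc, mem_Ioc, mem_empty_iff_false, iff_false]
      rintro ⟨h1, h2⟩
      exact h1 ⟨h2.1.le, h2.2⟩)
  refine ⟨μ, inferInstance, fun w hw => ?_⟩
  have hlim : Tendsto σ F (𝓝 μ) := by simpa [Tendsto, Ultrafilter.coe_map] using hμ
  have hPc := continuous_poissonKernel_circleMap hw
  obtain ⟨C, hC⟩ := exists_bound_poissonKernel_circleMap hw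
  have h1 := FiniteMeasure.tendsto_iff_forall_integral_tendsto.1 hlim
    (BoundedContinuousFunction.ofNormedAddCommGroup _ hPc C hC)
  refine tendsto_nhds_unique ?_ h1
  have h2 : Tendsto (fun r : ℝ => (g (r * w)).im) F (𝓝 (g w).im) := by
    have : ContinuousAt (fun r : ℝ => (g (r * w)).im) 1 := by
      refine Complex.continuous_im.continuousAt.comp ?_
      have hgw : ContinuousAt g (((1 : ℝ) : ℂ) * w) := by
        simpa using (hg.continuousOn.continuousAt (Metric.isOpen_ball.mem_nhds hw))
      exact ContinuousAt.comp (f := fun r : ℝ => (r : ℂ) * w) hgw (by fun_prop)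
    have h3 := this.tendsto.mono_left (hF.trans nhdsWithin_le_nhds)
    simpa using h3
  refine h2.congr' (hF ?_)
  filter_upwards [hIoo] with r hr
  rw [hσ r hr]
  exact ((integral_circleMeasure hg hpos hr _).trans
    (circleAverage_poissonKernel_mul_im hg hr hw)).symm

/-! ### Cayley transform and the Nevanlinna representation -/

/-- The Cayley transform from the unit disc to the upper half plane. -/
noncomputable def discToHalfPlane (w : ℂ) : ℂ := Complex.I * (1 + w) / (1 - w)

theorem discToHalfPlane_im (w : ℂ) :
    (discToHalfPlane w).im = (1 - ‖w‖ ^ 2) / ‖1 - w‖ ^ 2 := by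
  rw [discToHalfPlane, Complex.div_im, ← Complex.normSq_eq_norm_sq, ← Complex.normSq_eq_norm_sq,
    ← sub_div]
  congr 1
  simp [Complex.normSq_apply]
  ring

theorem discToHalfPlane_eq_re {ζ : ℂ} (hζ : ‖ζ‖ = 1) :
    discToHalfPlane ζ = ((discToHalfPlane ζ).re : ℂ) := by
  apply Complex.ext <;> simp [discToHalfPlane_im, hζ]

theorem add_I_ne_zero {z : ℂ} (hz : 0 ≤ z.im) : z + Complex.I ≠ 0 := by
  intro h
  have := congrArg Complex.im h
  simp at this
  linarith

theorem eq_of_discToHalfPlane {ζ : ℂ} (hζ : ‖ζ‖ = 1) (h1 : ζ ≠ 1) :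
    ζ = (((discToHalfPlane ζ).re : ℂ) - Complex.I) / (((discToHalfPlane ζ).re : ℂ) + Complex.I) := by
  rw [eq_div_iff (add_I_ne_zero (by simp)), ← discToHalfPlane_eq_re hζ, discToHalfPlane]
  have : 1 - ζ ≠ 0 := sub_ne_zero.2 h1.symm
  field_simp
  ring

theorem discToHalfPlane_cayley {z : ℂ} (hz : 0 < z.im) :
    discToHalfPlane ((z - Complex.I) / (z + Complex.I)) = z := by
  have h := add_I_ne_zero hz.le
  have h2 : 1 - (z - Complex.I) / (z + Complex.I) = 2 * Complex.I / (z + Complex.I) := by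
    field_simp
    ring
  rw [discToHalfPlane, h2]
  have := Complex.I_ne_zero
  field_simp
  ring

theorem one_sub_norm_cayley_sq {z : ℂ} (hz : 0 ≤ z.im) :
    1 - ‖(z - Complex.I) / (z + Complex.I)‖ ^ 2 = 4 * z.im / ‖z + Complex.I‖ ^ 2 := by
  have h : ‖z + Complex.I‖ ≠ 0 := norm_ne_zero_iff.2 (add_I_ne_zero hz)
  rw [norm_div, div_pow, one_sub_div (by positivity)]
  congr 1
  rw [← Complex.normSq_eq_norm_sq, ← Complex.normSq_eq_norm_sq]
  simp [Complex.normSq_apply]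
  ring

theorem cayley_mem_ball {z : ℂ} (hz : 0 < z.im) :
    (z - Complex.I) / (z + Complex.I) ∈ Metric.ball (0 : ℂ) 1 := by
  have h : 0 < ‖z + Complex.I‖ := norm_pos_iff.2 (add_I_ne_zero hz.le)
  have h1 := one_sub_norm_cayley_sq hz.le
  have h2 : 0 < 4 * z.im / ‖z + Complex.I‖ ^ 2 := by positivity
  rw [mem_ball_zero_iff]
  by_contra! hc
  nlinarith

/-- The boundary point `1` corresponds to infinity: an atom there produces the constant term of the
Julia quotient. -/
theorem poissonKernel_cayley_one {z : ℂ} (hz : 0 < z.im) :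
    poissonKernel 0 ((z - Complex.I) / (z + Complex.I)) 1 = z.im := by
  have h : ‖z + Complex.I‖ ≠ 0 := norm_ne_zero_iff.2 (add_I_ne_zero hz.le)
  have h2 : 1 - (z - Complex.I) / (z + Complex.I) = 2 * Complex.I / (z + Complex.I) := by
    have := add_I_ne_zero hz.le
    field_simp
    ring
  simp only [poissonKernel, sub_zero, norm_one, one_pow]
  rw [one_sub_norm_cayley_sq hz.le, h2, norm_div]
  simp
  field_simp
  ring

/-- The factor `1 + t²` becomes the density of the measure transported to the line, which is why
that measure integrates `(1 + t²)⁻¹`. -/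
theorem poissonKernel_cayley_ofReal {z : ℂ} (hz : 0 < z.im) (t : ℝ) :
    poissonKernel 0 ((z - Complex.I) / (z + Complex.I)) ((t - Complex.I) / (t + Complex.I)) =
      z.im * ((1 + t ^ 2) * ‖z - t‖ ^ (-2 * (1 : ℝ))) := by
  have h := add_I_ne_zero hz.le
  have ht : (t : ℂ) + Complex.I ≠ 0 := add_I_ne_zero (by simp)
  have hn : ‖z + Complex.I‖ ≠ 0 := norm_ne_zero_iff.2 h
  have hnt : ‖(t : ℂ) + Complex.I‖ ≠ 0 := norm_ne_zero_iff.2 ht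
  have h2 : (t - Complex.I) / (t + Complex.I) - (z - Complex.I) / (z + Complex.I) =
      -(2 * Complex.I) * (z - t) / ((t + Complex.I) * (z + Complex.I)) := by
    field_simp
    ring
  have h3 : ‖((t : ℂ) - Complex.I) / (t + Complex.I)‖ ^ 2 = 1 := by
    have := one_sub_norm_cayley_sq (z := (t : ℂ)) (by simp)
    simp only [Complex.ofReal_im, mul_zero, zero_div] at this
    linarith
  have h4 : ‖(t : ℂ) + Complex.I‖ ^ 2 = 1 + t ^ 2 := by
    rw [← Complex.normSq_eq_norm_sq]
    simp [Complex.normSq_apply]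
    ring
  have h5 : ‖z - t‖ ≠ 0 := by
    rw [norm_ne_zero_iff, sub_ne_zero]
    rintro rfl
    simp at hz
  have h6 : ‖z - t‖ ^ (-2 * (1 : ℝ)) = (‖z - t‖ ^ 2)⁻¹ := by
    rw [mul_one, Real.rpow_neg (norm_nonneg _)]
    norm_cast
  simp only [poissonKernel, sub_zero]
  rw [h3, one_sub_norm_cayley_sq hz.le, h2, h6, ← h4]
  simp
  field_simp
  ring

/-- The Nevanlinna representation of a function with nonnegative imaginary part. -/
theorem IsPick.exists_juliaQuotient_eq {f : ℂ → ℂ} (hf : IsPick f) :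
    ∃ (a : ℝ) (μ : Measure ℝ), Integrable (fun t : ℝ => (1 + t ^ 2) ^ (-(1 : ℝ))) μ ∧
      ∀ z : ℂ, 0 < z.im → juliaQuotient f z = a + ∫ t : ℝ, ‖z - t‖ ^ (-2 * (1 : ℝ)) ∂μ := by
  have hmaps : MapsTo discToHalfPlane (Metric.ball 0 1) {z : ℂ | 0 < z.im} := by
    intro w hw
    rw [mem_ball_zero_iff] at hw
    have h1 : 0 < ‖1 - w‖ := by
      rw [norm_pos_iff, sub_ne_zero]
      rintro rfl
      simp at hw
    rw [mem_ofPred_eq, discToHalfPlane_im]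
    have : 0 < 1 - ‖w‖ ^ 2 := by nlinarith [norm_nonneg w]
    positivity
  have hd : DifferentiableOn ℂ discToHalfPlane (Metric.ball 0 1) := by
    unfold discToHalfPlane
    refine DifferentiableOn.div (by fun_prop) (by fun_prop) fun w hw => ?_
    rw [sub_ne_zero]
    rintro rfl
    simp at hw
  obtain ⟨σ, hσ, hrep⟩ := exists_measure_im_eq_integral_poissonKernel
    (hf.analytic.differentiableOn.comp hd hmaps) fun w hw => hf.im_nonneg _ (hmaps hw)
  let T : ℝ → ℝ := fun θ => (discToHalfPlane (circleMap 0 1 θ)).re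
  have hT : Measurable T := by
    have := (continuous_circleMap 0 1).measurable
    unfold T discToHalfPlane
    fun_prop
  -- The angles sent to infinity are split off. On them `T` takes a meaningless value, from division
  -- by zero, so only the restriction of `σ` to `Sᶜ` is pushed forward.
  let S : Set ℝ := {θ | circleMap 0 1 θ = 1}
  have hS : MeasurableSet S := (continuous_circleMap 0 1).measurable (measurableSet_singleton 1)
  have hdens : Measurable fun t : ℝ => ENNReal.ofReal (1 + t ^ 2) := by fun_prop
  have hpos : ∀ t : ℝ, 0 < 1 + t ^ 2 := fun t => by positivity
  refine ⟨σ.real S, ((σ.restrict Sᶜ).map T).withDensity fun t => ENNReal.ofReal (1 + t ^ 2),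
    ?_, fun z hz => ?_⟩
  · rw [integrable_withDensity_iff_integrable_smul₀' hdens.aemeasurable (by simp)]
    refine (integrable_const (1 : ℝ)).congr (Eventually.of_forall fun t => ?_)
    simp only [ENNReal.toReal_ofReal (hpos t).le, smul_eq_mul, Real.rpow_neg_one]
    rw [mul_inv_cancel₀ (hpos t).ne']
  · have h1 := hrep _ (cayley_mem_ball hz)
    rw [Function.comp_apply, discToHalfPlane_cayley hz] at h1
    have hint : Integrable (fun θ => poissonKernel 0 ((z - Complex.I) / (z + Complex.I))
        (circleMap 0 1 θ)) σ := by
      obtain ⟨C, hC⟩ := exists_bound_poissonKernel_circleMap (cayley_mem_ball hz)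
      exact Integrable.of_bound
        (continuous_poissonKernel_circleMap (cayley_mem_ball hz)).aestronglyMeasurable C
        (Eventually.of_forall hC)
    rw [← integral_add_compl hS hint] at h1
    have h2 : ∫ θ in S, poissonKernel 0 ((z - Complex.I) / (z + Complex.I)) (circleMap 0 1 θ) ∂σ =
        σ.real S * z.im := by
      rw [setIntegral_congr_fun (g := fun _ => z.im) hS, setIntegral_const, smul_eq_mul]
      intro θ hθ
      simp only
      rw [show circleMap 0 1 θ = 1 from hθ, poissonKernel_cayley_one hz]
    have h3 : ∫ θ in Sᶜ, poissonKernel 0 ((z - Complex.I) / (z + Complex.I)) (circleMap 0 1 θ) ∂σ =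
        z.im * ∫ t : ℝ, (1 + t ^ 2) * ‖z - t‖ ^ (-2 * (1 : ℝ)) ∂((σ.restrict Sᶜ).map T) := by
      rw [integral_map hT.aemeasurable (Measurable.aestronglyMeasurable (by fun_prop)),
        ← integral_const_mul]
      refine setIntegral_congr_fun hS.compl fun θ hθ => ?_
      rw [← poissonKernel_cayley_ofReal hz, ← eq_of_discToHalfPlane (by simp [circleMap]) hθ]
    have h4 : ∫ t : ℝ, ‖z - t‖ ^ (-2 * (1 : ℝ))
          ∂(((σ.restrict Sᶜ).map T).withDensity fun t => ENNReal.ofReal (1 + t ^ 2)) =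
        ∫ t : ℝ, (1 + t ^ 2) * ‖z - t‖ ^ (-2 * (1 : ℝ)) ∂((σ.restrict Sᶜ).map T) := by
      rw [integral_withDensity_eq_integral_toReal_smul hdens (by simp)]
      refine integral_congr_ae (Eventually.of_forall fun t => ?_)
      simp only [ENNReal.toReal_ofReal (hpos t).le, smul_eq_mul]
    rw [juliaQuotient, h1, h2, h3, h4]
    field_simp

/-! ### Poisson integrals, boundary measure and the fractional Laplacian -/

/-- Every integrability statement about the kernels comes from this domination by the weight `(1 +
t²)⁻¹`, locally uniform in `x`. -/
theorem inv_sq_add_sq_le {y : ℝ} (hy : 0 < y) (x t : ℝ) :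
    ((x - t) ^ 2 + y ^ 2)⁻¹ ≤ 2 * (1 + (y ^ 2)⁻¹) * (1 + x ^ 2) * (1 + t ^ 2)⁻¹ := by
  have h1 : 1 + t ^ 2 ≤ 2 * (1 + x ^ 2) * (1 + (x - t) ^ 2) := by
    nlinarith [sq_nonneg (2 * x - t), sq_nonneg (x * (x - t))]
  have h2 : 1 + (x - t) ^ 2 ≤ (1 + (y ^ 2)⁻¹) * ((x - t) ^ 2 + y ^ 2) := by
    have : (y ^ 2)⁻¹ * y ^ 2 = 1 := inv_mul_cancel₀ (by positivity)
    have h3 : 0 ≤ (y ^ 2)⁻¹ * (x - t) ^ 2 := by positivity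
    nlinarith [sq_nonneg y]
  rw [inv_le_iff_one_le_mul₀ (by positivity), mul_right_comm, ← div_eq_mul_inv,
    one_le_div (by positivity)]
  calc 1 + t ^ 2 ≤ 2 * (1 + x ^ 2) * (1 + (x - t) ^ 2) := h1
    _ ≤ 2 * (1 + x ^ 2) * ((1 + (y ^ 2)⁻¹) * ((x - t) ^ 2 + y ^ 2)) := by gcongr
    _ = _ := by ring

theorem norm_sub_ofReal_rpow (z : ℂ) (t r : ℝ) :
    ‖z - t‖ ^ (-2 * r) = ((z.re - t) ^ 2 + z.im ^ 2) ^ (-r) := by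
  have : (z.re - t) ^ 2 + z.im ^ 2 = ‖z - t‖ ^ (2 : ℝ) := by
    rw [Real.rpow_two, ← Complex.normSq_eq_norm_sq, Complex.normSq_apply]
    simp
    ring
  rw [this, ← Real.rpow_mul (norm_nonneg _)]
  congr 1
  ring

theorem isLocallyFiniteMeasure_of_integrable {μ : Measure ℝ}
    (hμ : Integrable (fun t : ℝ => (1 + t ^ 2) ^ (-(1 : ℝ))) μ) : IsLocallyFiniteMeasure μ := by
  refine ⟨fun x => ⟨Metric.ball x 1, Metric.ball_mem_nhds x one_pos, ?_⟩⟩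
  have h := hμ.measure_norm_ge_lt_top (ε := (1 + (|x| + 1) ^ 2)⁻¹) (by positivity)
  refine lt_of_le_of_lt (measure_mono fun t ht => ?_) h
  rw [Metric.mem_ball, Real.dist_eq] at ht
  have h1 : |t| ≤ |x| + 1 := by
    have := abs_add_le (t - x) x
    rw [sub_add_cancel] at this
    linarith
  have h2 : t ^ 2 ≤ (|x| + 1) ^ 2 := by
    rw [← sq_abs t]
    gcongr
  rw [mem_ofPred_eq, Real.rpow_neg_one, Real.norm_of_nonneg (by positivity)]
  gcongr

theorem sq_add_sq_rpow_le {s : ℝ} (hs : 0 ≤ s) {y : ℝ} (hy : 0 < y) (x t : ℝ) :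
    ((x - t) ^ 2 + y ^ 2) ^ (-(1 + s)) ≤
      (y ^ 2) ^ (-s) * (2 * (1 + (y ^ 2)⁻¹) * (1 + x ^ 2)) * (1 + t ^ 2) ^ (-(1 : ℝ)) := by
  have h0 : 0 < (x - t) ^ 2 + y ^ 2 := by positivity
  rw [show -(1 + s) = -s + -1 by ring, Real.rpow_add h0, mul_assoc, Real.rpow_neg_one,
    Real.rpow_neg_one]
  refine mul_le_mul ?_ (inv_sq_add_sq_le hy x t) (by positivity) (by positivity)
  exact Real.rpow_le_rpow_of_nonpos (by positivity) (by nlinarith [sq_nonneg (x - t)]) (by linarith)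

theorem integrable_sq_add_sq_rpow {μ : Measure ℝ}
    (hμ : Integrable (fun t : ℝ => (1 + t ^ 2) ^ (-(1 : ℝ))) μ) {s : ℝ} (hs : 0 ≤ s) {y : ℝ}
    (hy : 0 < y) (x : ℝ) : Integrable (fun t : ℝ => ((x - t) ^ 2 + y ^ 2) ^ (-(1 + s))) μ := by
  refine (hμ.const_mul ((y ^ 2) ^ (-s) * (2 * (1 + (y ^ 2)⁻¹) * (1 + x ^ 2)))).mono'
    (Measurable.aestronglyMeasurable (by fun_prop)) (Eventually.of_forall fun t => ?_)
  rw [Real.norm_of_nonneg (by positivity)]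
  exact sq_add_sq_rpow_le hs hy x t

/-- The Poisson integral of `φ` at `t + i y`, up to the factor `π`. -/
theorem integral_mul_poisson_eq (φ : ℝ → ℝ) {y : ℝ} (hy : 0 < y) (t : ℝ) :
    ∫ x, φ x * (y * ((x - t) ^ 2 + y ^ 2)⁻¹) = ∫ v, φ (t + y * v) * (1 + v ^ 2)⁻¹ := by
  have h1 := Measure.integral_comp_mul_left
    (fun u => φ (t + u) * (y ^ 2 * (u ^ 2 + y ^ 2)⁻¹)) y
  have h2 := integral_add_left_eq_self (μ := volume)
    (fun x => φ x * (y ^ 2 * ((x - t) ^ 2 + y ^ 2)⁻¹)) t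
  simp only [add_sub_cancel_left] at h2
  rw [h2, abs_of_pos (inv_pos.2 hy), smul_eq_mul, ← integral_const_mul] at h1
  calc _ = ∫ x, y⁻¹ * (φ x * (y ^ 2 * ((x - t) ^ 2 + y ^ 2)⁻¹)) := by
        refine integral_congr_ae (Eventually.of_forall fun x => ?_)
        simp only
        field_simp
    _ = _ := by
        rw [← h1]
        refine integral_congr_ae (Eventually.of_forall fun v => ?_)
        simp only
        have : (y * v) ^ 2 + y ^ 2 = y ^ 2 * (1 + v ^ 2) := by ring
        rw [this]
        field_simp

theorem exists_one_add_sq_mul_abs_le {φ : ℝ → ℝ} (hφ : Continuous φ) (hc : HasCompactSupport φ) :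
    ∃ A, 0 ≤ A ∧ ∀ x, (1 + x ^ 2) * |φ x| ≤ A := by
  have h1 : HasCompactSupport fun x : ℝ => (1 + x ^ 2) * φ x := hc.mul_left
  obtain ⟨A, hA⟩ := h1.exists_bound_of_continuous (by fun_prop)
  refine ⟨A, (norm_nonneg _).trans (hA 0), fun x => ?_⟩
  have := hA x
  rwa [norm_mul, Real.norm_of_nonneg (by positivity)] at this

/-- The bound does not depend on `y`, so it supplies a dominating function for the limit `y ↓ 0`. It
rests on `1 + t² ≤ 2(1 + (t + yv)²) + 2y²v²`: the first term is absorbed by the decay of `φ`, the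
second by that of the kernel. -/
theorem one_add_sq_mul_abs_poisson_le {φ : ℝ → ℝ} (hφ : Continuous φ) (hc : HasCompactSupport φ)
    {A : ℝ} (hA : ∀ x, (1 + x ^ 2) * |φ x| ≤ A) {y : ℝ} (hy : 0 < y) (hy1 : y < 1) (t : ℝ) :
    (1 + t ^ 2) * |∫ v, φ (t + y * v) * (1 + v ^ 2)⁻¹| ≤ 2 * A * Real.pi + 2 * ∫ x, |φ x| := by
  have hint : Integrable fun v => |φ (t + y * v)| := by
    have h := (hφ.abs.integrable_of_hasCompactSupport (μ := (volume : Measure ℝ)) hc.norm).comp_add_left t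
    exact h.comp_mul_left' hy.ne'
  have hval : ∫ v, |φ (t + y * v)| = y⁻¹ * ∫ x, |φ x| := by
    rw [Measure.integral_comp_mul_left (fun u => |φ (t + u)|) y,
      integral_add_left_eq_self (μ := volume) (fun x => |φ x|) t, abs_of_pos (inv_pos.2 hy),
      smul_eq_mul]
  have hnn : 0 ≤ ∫ x, |φ x| := integral_nonneg fun x => abs_nonneg _
  calc (1 + t ^ 2) * |∫ v, φ (t + y * v) * (1 + v ^ 2)⁻¹|
      = ‖∫ v, (1 + t ^ 2) * (φ (t + y * v) * (1 + v ^ 2)⁻¹)‖ := by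
        rw [integral_const_mul, norm_mul, Real.norm_of_nonneg (by positivity), Real.norm_eq_abs]
    _ ≤ ∫ v, (2 * A * (1 + v ^ 2)⁻¹ + 2 * y ^ 2 * |φ (t + y * v)|) := by
        refine norm_integral_le_of_norm_le ((integrable_inv_one_add_sq.const_mul _).add
          (hint.const_mul _)) (Eventually.of_forall fun v => ?_)
        have h1 := hA (t + y * v)
        have h2 : (1 + t ^ 2) * |φ (t + y * v)| ≤ 2 * A + 2 * y ^ 2 * |φ (t + y * v)| * v ^ 2 := by
          have : 1 + t ^ 2 ≤ 2 * (1 + (t + y * v) ^ 2) + 2 * y ^ 2 * v ^ 2 := by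
            nlinarith [sq_nonneg (t + 2 * (y * v))]
          nlinarith [mul_le_mul_of_nonneg_right this (abs_nonneg (φ (t + y * v)))]
        rw [norm_mul, norm_mul, Real.norm_of_nonneg (show 0 ≤ 1 + t ^ 2 by positivity),
          Real.norm_of_nonneg (show 0 ≤ (1 + v ^ 2)⁻¹ by positivity), Real.norm_eq_abs, ← mul_assoc,
          mul_inv_le_iff₀ (by positivity), add_mul (2 * A * _), mul_assoc (2 * A),
          inv_mul_cancel₀ (by positivity)]
        have h3 : 0 ≤ 2 * y ^ 2 * |φ (t + y * v)| := by positivity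
        nlinarith
    _ = 2 * A * Real.pi + 2 * y * ∫ x, |φ x| := by
        rw [integral_add (integrable_inv_one_add_sq.const_mul _) (hint.const_mul _),
          integral_const_mul, integral_const_mul, integral_univ_inv_one_add_sq, hval]
        field_simp
    _ ≤ _ := by nlinarith

theorem tendsto_poisson {φ : ℝ → ℝ} (hφ : Continuous φ) {A : ℝ} (hA : ∀ x, |φ x| ≤ A) (t : ℝ) :
    Tendsto (fun y : ℝ => ∫ v, φ (t + y * v) * (1 + v ^ 2)⁻¹) (𝓝[>] 0) (𝓝 (Real.pi * φ t)) := by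
  rw [← integral_univ_inv_one_add_sq, mul_comm, ← integral_const_mul]
  refine tendsto_integral_filter_of_dominated_convergence (fun v => A * (1 + v ^ 2)⁻¹)
    (Eventually.of_forall fun y => Continuous.aestronglyMeasurable ?_)
    (Eventually.of_forall fun y => Eventually.of_forall fun v => ?_)
    (integrable_inv_one_add_sq.const_mul _) (Eventually.of_forall fun v => ?_)
  · exact (hφ.comp (by fun_prop)).mul (Continuous.inv₀ (by fun_prop) fun v => by positivity)
  · rw [norm_mul, Real.norm_of_nonneg (show 0 ≤ (1 + v ^ 2)⁻¹ by positivity)]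
    gcongr
    exact hA _
  · refine Tendsto.mul_const _ ?_
    have : Continuous fun y : ℝ => φ (t + y * v) := hφ.comp (by fun_prop)
    simpa using (this.tendsto 0).mono_left nhdsWithin_le_nhds

/-- Fubini moves the Poisson kernel from `μ` onto `φ`; the smoothed `φ` tends pointwise to `π φ`,
and dominated convergence finishes. -/
theorem tendsto_integral_mul_poisson {μ : Measure ℝ}
    (hμ : Integrable (fun t : ℝ => (1 + t ^ 2) ^ (-(1 : ℝ))) μ) {φ : ℝ → ℝ} (hφ : Continuous φ)
    (hc : HasCompactSupport φ) :
    Tendsto (fun y : ℝ => ∫ x, φ x * (y * ∫ t, ((x - t) ^ 2 + y ^ 2)⁻¹ ∂μ)) (𝓝[>] 0)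
      (𝓝 (Real.pi * ∫ t, φ t ∂μ)) := by
  have := isLocallyFiniteMeasure_of_integrable hμ
  obtain ⟨A, hA0, hA⟩ := exists_one_add_sq_mul_abs_le hφ hc
  have hA' : ∀ x, |φ x| ≤ A := fun x => le_trans (by nlinarith [abs_nonneg (φ x), sq_nonneg x]) (hA x)
  have hev : ∀ᶠ y in 𝓝[>] (0 : ℝ), y ∈ Ioo (0 : ℝ) 1 := Ioo_mem_nhdsGT one_pos
  simp only [Real.rpow_neg_one] at hμ
  have hswap : ∀ y : ℝ, 0 < y → ∫ x, φ x * (y * ∫ t, ((x - t) ^ 2 + y ^ 2)⁻¹ ∂μ) =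
      ∫ t, (∫ v, φ (t + y * v) * (1 + v ^ 2)⁻¹) ∂μ := by
    intro y hy
    simp only [← integral_const_mul]
    rw [integral_integral_swap]
    · simp only [integral_mul_poisson_eq φ hy]
    · have h1 : Integrable fun x : ℝ => y * (2 * (1 + (y ^ 2)⁻¹)) * ((1 + x ^ 2) * φ x) := by
        refine Integrable.const_mul (Continuous.integrable_of_hasCompactSupport (by fun_prop) ?_) _
        exact hc.mul_left
      refine (h1.mul_prod hμ).mono (Measurable.aestronglyMeasurable ?_)
        (Eventually.of_forall fun p => ?_)
      · have := hφ.measurable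
        unfold Function.uncurry
        fun_prop
      · obtain ⟨x, t⟩ := p
        have := inv_sq_add_sq_le hy x t
        simp only [Function.uncurry, norm_mul]
        rw [Real.norm_of_nonneg hy.le, Real.norm_of_nonneg (show 0 ≤ (1 + t ^ 2)⁻¹ by positivity),
          Real.norm_of_nonneg (show 0 ≤ ((x - t) ^ 2 + y ^ 2)⁻¹ by positivity),
          Real.norm_of_nonneg (show 0 ≤ 1 + x ^ 2 by positivity),
          Real.norm_of_nonneg (show 0 ≤ 1 + (y ^ 2)⁻¹ by positivity),
          Real.norm_of_nonneg (show (0 : ℝ) ≤ 2 by positivity)]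
        calc ‖φ x‖ * (y * ((x - t) ^ 2 + y ^ 2)⁻¹) ≤
            ‖φ x‖ * (y * (2 * (1 + (y ^ 2)⁻¹) * (1 + x ^ 2) * (1 + t ^ 2)⁻¹)) := by gcongr
          _ = _ := by ring
  rw [← integral_const_mul]
  refine Tendsto.congr' (f₁ := fun y : ℝ => ∫ t, (∫ v, φ (t + y * v) * (1 + v ^ 2)⁻¹) ∂μ)
    (by filter_upwards [hev] with y hy using (hswap y hy.1).symm) ?_
  refine tendsto_integral_filter_of_dominated_convergence
    (fun t => (2 * A * Real.pi + 2 * ∫ x, |φ x|) * (1 + t ^ 2)⁻¹) ?_ ?_ (hμ.const_mul _)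
    (Eventually.of_forall fun t => tendsto_poisson hφ hA' t)
  · refine Eventually.of_forall fun y => StronglyMeasurable.aestronglyMeasurable ?_
    refine StronglyMeasurable.integral_prod_right (f := fun t v => φ (t + y * v) * (1 + v ^ 2)⁻¹) ?_
    have := hφ.measurable
    exact Measurable.stronglyMeasurable (by unfold Function.uncurry; fun_prop)
  · filter_upwards [hev] with y hy
    refine Eventually.of_forall fun t => ?_
    rw [← div_eq_mul_inv, le_div_iff₀ (by positivity), mul_comm]
    exact one_add_sq_mul_abs_poisson_le hφ hc hA hy.1 hy.2 t

theorem integral_norm_sub_rpow_two (z : ℂ) (μ : Measure ℝ) :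
    ∫ t : ℝ, ‖z - t‖ ^ (-2 * (1 : ℝ)) ∂μ = ∫ t, ((z.re - t) ^ 2 + z.im ^ 2)⁻¹ ∂μ := by
  simp only [norm_sub_ofReal_rpow, Real.rpow_neg_one]

theorem continuous_integral_poisson {μ : Measure ℝ}
    (hμ : Integrable (fun t : ℝ => (1 + t ^ 2) ^ (-(1 : ℝ))) μ) {s : ℝ} (hs : 0 ≤ s) {y : ℝ}
    (hy : 0 < y) : Continuous fun x => ∫ t, ((x - t) ^ 2 + y ^ 2) ^ (-(1 + s)) ∂μ := by
  rw [continuous_iff_continuousAt]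
  intro x₀
  refine continuousAt_of_dominated (bound := fun t => (y ^ 2) ^ (-s) * (2 * (1 + (y ^ 2)⁻¹) *
    (1 + (|x₀| + 1) ^ 2)) * (1 + t ^ 2) ^ (-(1 : ℝ))) ?_ ?_ (hμ.const_mul _) ?_
  · exact Eventually.of_forall fun x => Measurable.aestronglyMeasurable (by fun_prop)
  · filter_upwards [Metric.ball_mem_nhds x₀ one_pos] with x hx
    refine Eventually.of_forall fun t => ?_
    rw [Metric.mem_ball, Real.dist_eq] at hx
    have h1 : |x| ≤ |x₀| + 1 := by
      have := abs_add_le (x - x₀) x₀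
      rw [sub_add_cancel] at this
      linarith
    have h2 : x ^ 2 ≤ (|x₀| + 1) ^ 2 := by
      rw [← sq_abs x]
      gcongr
    rw [Real.norm_of_nonneg (by positivity)]
    refine (sq_add_sq_rpow_le hs hy x t).trans ?_
    gcongr
  · refine Eventually.of_forall fun t => ContinuousAt.rpow_const (by fun_prop) (Or.inl ?_)
    positivity

/-- The boundary measure of a function represented by two measures. -/
theorem tendsto_of_juliaQuotient_eq {f : ℂ → ℂ} {c : ℝ} {μ ν : Measure ℝ}
    (hμ : Integrable (fun t : ℝ => (1 + t ^ 2) ^ (-(1 : ℝ))) μ)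
    (hν : Integrable (fun t : ℝ => (1 + t ^ 2) ^ (-(1 : ℝ))) ν)
    (h : ∀ z : ℂ, 0 < z.im → juliaQuotient f z =
      c + ((∫ t : ℝ, ‖z - t‖ ^ (-2 * (1 : ℝ)) ∂μ) - ∫ t : ℝ, ‖z - t‖ ^ (-2 * (1 : ℝ)) ∂ν))
    {φ : ℝ → ℝ} (hφ : Continuous φ) (hc : HasCompactSupport φ) :
    Tendsto (fun y : ℝ => ∫ x : ℝ, φ x * (f (x + y * Complex.I)).im) (𝓝[>] 0)
      (𝓝 (Real.pi * ∫ t, φ t ∂μ - Real.pi * ∫ t, φ t ∂ν)) := by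
  have h1 := (tendsto_integral_mul_poisson hμ hφ hc).sub (tendsto_integral_mul_poisson hν hφ hc)
  have h2 : Tendsto (fun y : ℝ => y * c * ∫ x, φ x) (𝓝[>] 0) (𝓝 0) := by
    have : Continuous fun y : ℝ => y * c * ∫ x, φ x := by fun_prop
    simpa using (this.tendsto 0).mono_left nhdsWithin_le_nhds
  have h3 := h2.add h1
  rw [zero_add] at h3
  refine h3.congr' ?_
  filter_upwards [self_mem_nhdsWithin] with y (hy : 0 < y)
  have hint : ∀ {ρ : Measure ℝ}, Integrable (fun t : ℝ => (1 + t ^ 2) ^ (-(1 : ℝ))) ρ →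
      Integrable fun x => φ x * (y * ∫ t, ((x - t) ^ 2 + y ^ 2)⁻¹ ∂ρ) := by
    intro ρ hρ
    have hcont := continuous_integral_poisson hρ le_rfl hy
    simp only [add_zero, Real.rpow_neg_one] at hcont
    exact (hφ.mul (hcont.const_mul y)).integrable_of_hasCompactSupport hc.mul_right
  have hφi : Integrable φ := hφ.integrable_of_hasCompactSupport hc
  have hsub : Integrable fun x => φ x * (y * ∫ t, ((x - t) ^ 2 + y ^ 2)⁻¹ ∂μ) -
      φ x * (y * ∫ t, ((x - t) ^ 2 + y ^ 2)⁻¹ ∂ν) := (hint hμ).sub (hint hν)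
  rw [← integral_sub (hint hμ) (hint hν), ← integral_const_mul,
    ← integral_add (hφi.const_mul _) hsub]
  refine integral_congr_ae (Eventually.of_forall fun x => ?_)
  have hz := h (x + y * Complex.I) (by simpa using hy)
  rw [integral_norm_sub_rpow_two, integral_norm_sub_rpow_two, juliaQuotient] at hz
  simp only [Complex.add_re, Complex.ofReal_re, Complex.mul_re, Complex.I_re, mul_zero,
    Complex.ofReal_im, Complex.I_im, mul_one, sub_self, add_zero, Complex.add_im, Complex.mul_im,
    zero_add] at hz
  rw [div_eq_iff hy.ne'] at hz
  simp only [hz]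
  ring

theorem eq_of_forall_integral_eq {μ ν : Measure ℝ} [IsLocallyFiniteMeasure μ]
    [IsLocallyFiniteMeasure ν]
    (h : ∀ φ : ℝ → ℝ, Continuous φ → HasCompactSupport φ → ∫ t, φ t ∂μ = ∫ t, φ t ∂ν) : μ = ν :=
  Measure.ext_of_integral_eq_on_compactlySupported fun φ => h φ φ.continuous φ.hasCompactSupport

/-- The fractional Laplacian of the Julia quotient is given by the Nevanlinna measure. -/
theorem IsPick.fracLaplacian_juliaQuotient {f : ℂ → ℂ} (hf : IsPick f) (s : ℝ) (hs : 0 ≤ s) :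
    Integrable (fun t : ℝ => (1 + t ^ 2) ^ (-(1 : ℝ))) (nevanlinnaMeasure f) ∧
      ∀ z : ℂ, 0 < z.im → fracLaplacian 1 s (juliaQuotient f) z =
        Real.Gamma (1 + s) ^ 2 / Real.pi *
          ∫ t, ((z.re - t) ^ 2 + z.im ^ 2) ^ (-(1 + s)) ∂(nevanlinnaMeasure f) := by
  obtain ⟨a, μ₀, hμ₀, hrep⟩ := hf.exists_juliaQuotient_eq
  have hlf := isLocallyFiniteMeasure_of_integrable hμ₀
  have hrep' : ∀ z : ℂ, 0 < z.im → juliaQuotient f z = a + ((∫ t : ℝ, ‖z - t‖ ^ (-2 * (1 : ℝ)) ∂μ₀) -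
      ∫ t : ℝ, ‖z - t‖ ^ (-2 * (1 : ℝ)) ∂(0 : Measure ℝ)) := by simpa using hrep
  -- The factor `π` is the total integral of the unnormalised Poisson kernel; it is taken in `ℝ≥0`
  -- so that it can scale a measure.
  obtain ⟨κ, hκ⟩ : ∃ κ : ℝ≥0, (κ : ℝ) = Real.pi := ⟨⟨Real.pi, Real.pi_pos.le⟩, rfl⟩
  have hlim : ∀ φ : ℝ → ℝ, Continuous φ → HasCompactSupport φ →
      Tendsto (fun y : ℝ => ∫ x : ℝ, φ x * (f (x + y * Complex.I)).im) (𝓝[>] 0)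
        (𝓝 (∫ x, φ x ∂(κ • μ₀))) := by
    intro φ hφ hc
    have := tendsto_of_juliaQuotient_eq hμ₀ integrable_zero_measure hrep' hφ hc
    rw [integral_smul_nnreal_measure, NNReal.smul_def, smul_eq_mul, hκ]
    simpa using this
  have hex : ∃ μ, IsNevanlinnaMeasure f μ := ⟨κ • μ₀, inferInstance, hlim⟩
  -- The definition only chooses some weak limit; limits against test functions are unique, so the
  -- choice is harmless.
  have hN : nevanlinnaMeasure f = κ • μ₀ := by
    have hspec := hex.choose_spec
    rw [nevanlinnaMeasure, dif_pos hex]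
    have := hspec.1
    exact eq_of_forall_integral_eq fun φ hφ hc =>
      tendsto_nhds_unique (hspec.2 φ hφ hc) (hlim φ hφ hc)
  refine ⟨hN ▸ hμ₀.smul_measure_nnreal, fun z hz => ?_⟩
  have hfrac : ∃ v, IsFracLaplacian 1 s (juliaQuotient f) v :=
    ⟨_, a, μ₀, 0, hμ₀, integrable_zero_measure, fun z hz => ⟨hrep' z hz, rfl⟩⟩
  obtain ⟨c, μ, ν, hμ, hν, hv⟩ := hfrac.choose_spec
  have hμl := isLocallyFiniteMeasure_of_integrable hμ
  have hνl := isLocallyFiniteMeasure_of_integrable hν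
  have hνμ := isLocallyFiniteMeasure_of_integrable (hν.add_measure hμ₀)
  -- The value of `fracLaplacian` is read from some chosen pair `μ`, `ν`. Comparing boundary limits
  -- shows `μ - ν = μ₀`, written additively to avoid signed measures; the additive constant leaves
  -- no trace in the limit.
  have hsum : μ = ν + μ₀ := by
    refine eq_of_forall_integral_eq fun φ hφ hc => ?_
    have h1 := tendsto_nhds_unique (hlim φ hφ hc)
      (tendsto_of_juliaQuotient_eq hμ hν (fun z hz => (hv z hz).1) hφ hc)
    rw [integral_smul_nnreal_measure, NNReal.smul_def, smul_eq_mul, hκ, ← mul_sub] at h1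
    rw [integral_add_measure (hφ.integrable_of_hasCompactSupport hc)
      (hφ.integrable_of_hasCompactSupport hc), mul_left_cancel₀ Real.pi_ne_zero h1]
    ring
  rw [fracLaplacian, dif_pos hfrac, (hv z hz).2, hsum, hN, integral_smul_nnreal_measure]
  simp only [norm_sub_ofReal_rpow]
  rw [integral_add_measure (integrable_sq_add_sq_rpow hν hs hz _)
    (integrable_sq_add_sq_rpow hμ₀ hs hz _), NNReal.smul_def, smul_eq_mul, hκ]
  simp only [Real.Gamma_one]
  have := Real.pi_ne_zero
  field_simp
  ring

/-! ### The Stieltjes identity for the derivative of the reciprocal -/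

/-- Integration by parts for two Stieltjes functions. -/
theorem lintegral_leftLim_sub_eq (G S : StieltjesFunction ℝ) (a b : ℝ) :
    ∫⁻ t in Ioc a b, ENNReal.ofReal (Function.leftLim G t - G a) ∂S.measure =
      ∫⁻ u in Ioc a b, ENNReal.ofReal (S b - S u) ∂G.measure := by
  -- The triangle `a < u < t ≤ b` is sliced both ways. Strictness of `u < t` is what gives a left
  -- limit of `G` on one side and the right-continuous value of `S` on the other.
  let E : Set (ℝ × ℝ) := {p | a < p.2 ∧ p.2 < p.1 ∧ p.1 ≤ b}
  have hE : MeasurableSet E :=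
    (measurableSet_lt measurable_const measurable_snd).inter
      ((measurableSet_lt measurable_snd measurable_fst).inter
        (measurableSet_le measurable_fst measurable_const))
  have h1 := Measure.prod_apply (μ := S.measure) (ν := G.measure) hE
  have h2 := Measure.prod_apply_symm (μ := S.measure) (ν := G.measure) hE
  rw [h2] at h1
  rw [← lintegral_indicator measurableSet_Ioc, ← lintegral_indicator measurableSet_Ioc]
  convert h1.symm using 3 with t u
  · by_cases ht : t ∈ Ioc a b
    · rw [indicator_of_mem ht, ← G.measure_Ioo]
      congr 1
      ext u
      simp only [E, mem_preimage, mem_ofPred_eq, mem_Ioo]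
      exact ⟨fun h => ⟨h.1, h.2, ht.2⟩, fun h => ⟨h.1, h.2.1⟩⟩
    · rw [indicator_of_notMem ht, eq_comm]
      convert measure_empty (μ := G.measure)
      ext u
      simp only [E, mem_preimage, mem_ofPred_eq, mem_empty_iff_false, iff_false]
      exact fun h => ht ⟨h.1.trans h.2.1, h.2.2⟩
  · by_cases hu : u ∈ Ioc a b
    · rw [indicator_of_mem hu, ← S.measure_Ioc]
      congr 1
      ext t
      simp only [E, mem_preimage, mem_ofPred_eq, mem_Ioc]
      exact ⟨fun h => ⟨hu.1, h.1, h.2⟩, fun h => h.2⟩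
    · rw [indicator_of_notMem hu, eq_comm]
      convert measure_empty (μ := S.measure)
      ext t
      simp only [E, mem_preimage, mem_ofPred_eq, mem_empty_iff_false, iff_false]
      exact fun h => hu ⟨h.1, h.2.1.le.trans h.2.2⟩

/-- The Stieltjes function `- 1 / G`, frozen to the left of `e`. -/
noncomputable def negInv (G : StieltjesFunction ℝ) (e : ℝ) (he : 0 < G e) : StieltjesFunction ℝ where
  toFun x := -(G (max e x))⁻¹
  mono' x y hxy := by
    have h1 : 0 < G (max e x) := he.trans_le (G.mono (le_max_left _ _))
    have h2 : G (max e x) ≤ G (max e y) := G.mono (max_le_max_left e hxy)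
    exact neg_le_neg (inv_anti₀ h1 h2)
  right_continuous' x := by
    have h1 : 0 < G (max e x) := he.trans_le (G.mono (le_max_left _ _))
    have h2 : ContinuousWithinAt (fun x => G (max e x)) (Ici x) x := ?_
    · exact (h2.inv₀ h1.ne').neg
    refine (G.right_continuous (max e x)).comp (t := Ici (max e x))
      (by fun_prop) fun y hy => ?_
    exact max_le_max_left e hy

theorem negInv_apply (G : StieltjesFunction ℝ) {e : ℝ} (he : 0 < G e) {x : ℝ} (hx : e ≤ x) :
    negInv G e he x = -(G x)⁻¹ := by
  change -(G (max e x))⁻¹ = _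
  rw [max_eq_right hx]

theorem leftLim_pos (G : StieltjesFunction ℝ) {e : ℝ} (he : 0 < G e) {x : ℝ} (hx : e < x) :
    0 < Function.leftLim G x := he.trans_le (G.mono.le_leftLim hx)

theorem leftLim_negInv (G : StieltjesFunction ℝ) {e : ℝ} (he : 0 < G e) {x : ℝ} (hx : e < x) :
    Function.leftLim (negInv G e he) x = -(Function.leftLim G x)⁻¹ := by
  refine leftLim_eq_of_tendsto ?_
  have h := ((G.mono.tendsto_leftLim x).inv₀ (leftLim_pos G he hx).ne').neg
  refine h.congr' ?_
  filter_upwards [Ioo_mem_nhdsLT hx] with y hy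
  rw [negInv_apply G he hy.1.le]

/-- Integration by parts with `S = -1/G`; the two boundary terms `G(a)(1/G(a) - 1/G(b))` and `(G(b)
- G(a))/G(b)` agree. -/
theorem lintegral_leftLim_negInv (G : StieltjesFunction ℝ) {e : ℝ} (he : 0 < G e) {a b : ℝ}
    (ha : e ≤ a) (hab : a ≤ b) :
    ∫⁻ t in Ioc a b, ENNReal.ofReal (Function.leftLim G t) ∂(negInv G e he).measure =
      ∫⁻ u in Ioc a b, ENNReal.ofReal (G u)⁻¹ ∂G.measure := by
  have hGa : 0 < G a := he.trans_le (G.mono ha)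
  have hGb : 0 < G b := hGa.trans_le (G.mono hab)
  have h1 : ∫⁻ t in Ioc a b, ENNReal.ofReal (Function.leftLim G t) ∂(negInv G e he).measure =
      ∫⁻ t in Ioc a b, ENNReal.ofReal (Function.leftLim G t - G a) ∂(negInv G e he).measure +
        ENNReal.ofReal (G a * ((G a)⁻¹ - (G b)⁻¹)) := by
    have : ENNReal.ofReal (G a * ((G a)⁻¹ - (G b)⁻¹)) =
        ∫⁻ t in Ioc a b, ENNReal.ofReal (G a) ∂(negInv G e he).measure := by
      rw [setLIntegral_const, StieltjesFunction.measure_Ioc, negInv_apply G he ha,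
        negInv_apply G he (ha.trans hab), ← ENNReal.ofReal_mul hGa.le]
      congr 1
      ring
    rw [this, ← lintegral_add_right _ measurable_const]
    refine setLIntegral_congr_fun measurableSet_Ioc fun t ht => ?_
    rw [← ENNReal.ofReal_add (sub_nonneg.2 (G.mono.le_leftLim ht.1)) hGa.le, sub_add_cancel]
  have h2 : ∫⁻ u in Ioc a b, ENNReal.ofReal (G u)⁻¹ ∂G.measure =
      ∫⁻ u in Ioc a b, ENNReal.ofReal (negInv G e he b - negInv G e he u) ∂G.measure +
        ENNReal.ofReal ((G b)⁻¹ * (G b - G a)) := by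
    have : ENNReal.ofReal ((G b)⁻¹ * (G b - G a)) =
        ∫⁻ u in Ioc a b, ENNReal.ofReal (G b)⁻¹ ∂G.measure := by
      rw [setLIntegral_const, StieltjesFunction.measure_Ioc, ← ENNReal.ofReal_mul (by positivity)]
    rw [this, ← lintegral_add_right _ measurable_const]
    refine setLIntegral_congr_fun measurableSet_Ioc fun u hu => ?_
    have hnn : 0 ≤ negInv G e he b - negInv G e he u := sub_nonneg.2 ((negInv G e he).mono hu.2)
    rw [← ENNReal.ofReal_add hnn (by positivity), negInv_apply G he (ha.trans hab),
      negInv_apply G he (ha.trans hu.1.le)]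
    congr 1
    ring
  rw [h1, h2, lintegral_leftLim_sub_eq]
  congr 2
  field_simp

theorem withDensity_leftLim_negInv (G : StieltjesFunction ℝ) {e : ℝ} (he : 0 < G e) :
    ((negInv G e he).measure.restrict (Ioi e)).withDensity
        (fun t => ENNReal.ofReal (Function.leftLim G t)) =
      (G.measure.restrict (Ioi e)).withDensity fun t => ENNReal.ofReal (G t)⁻¹ := by
  have hle : ∀ {a b : ℝ}, Ioc a b ∩ Ioi e = Ioc (max a e) b := fun {a b} => by
    ext t
    simp only [mem_inter_iff, mem_Ioc, mem_Ioi, max_lt_iff]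
    tauto
  have hval : ∀ a b : ℝ, ∀ μ : Measure ℝ, ∀ g : ℝ → ℝ≥0∞,
      (μ.restrict (Ioi e)).withDensity g (Ioc a b) = ∫⁻ t in Ioc (max a e) b, g t ∂μ := by
    intro a b μ g
    rw [withDensity_apply _ measurableSet_Ioc, Measure.restrict_restrict measurableSet_Ioc, hle]
  have hlf : IsLocallyFiniteMeasure ((G.measure.restrict (Ioi e)).withDensity
      fun t => ENNReal.ofReal (G t)⁻¹) := by
    refine ⟨fun x => ⟨Ioc (x - 1) (x + 1), Ioc_mem_nhds (by linarith) (by linarith), ?_⟩⟩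
    rw [hval]
    refine lt_of_le_of_lt (setLIntegral_mono measurable_const
      (g := fun _ => ENNReal.ofReal (G e)⁻¹) fun t ht => ?_) ?_
    · exact ENNReal.ofReal_le_ofReal (inv_anti₀ he (G.mono ((le_max_right _ _).trans ht.1.le)))
    · rw [setLIntegral_const, StieltjesFunction.measure_Ioc]
      exact ENNReal.mul_lt_top ENNReal.ofReal_lt_top ENNReal.ofReal_lt_top
  refine (Measure.ext_of_Ioc _ _ fun {a b} hab => ?_).symm
  rw [hval, hval]
  rcases le_total (max a e) b with h | h
  · exact (lintegral_leftLim_negInv G he (le_max_right _ _) h).symm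
  · simp [Ioc_eq_empty_of_le h]

/-- Dividing the identity `G(t-) d(-1/G) = dG/G` by `G(t-)` gives `d(-1/G) = dG/(G(t-)G(t))`, atoms
included; the half-open interval makes both endpoints left limits. -/
theorem lintegral_Ico_inv_leftLim_mul (G : StieltjesFunction ℝ) {e : ℝ} (he : 0 < G e) {r b : ℝ}
    (hr : e < r) (hb : r ≤ b) :
    ∫⁻ t in Ico r b, ENNReal.ofReal (Function.leftLim G t * G t)⁻¹ ∂G.measure =
      ENNReal.ofReal ((Function.leftLim G r)⁻¹ - (Function.leftLim G b)⁻¹) := by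
  have hmL : Measurable fun t => ENNReal.ofReal (Function.leftLim G t) :=
    G.mono.leftLim.measurable.ennreal_ofReal
  have hmG : Measurable fun t => ENNReal.ofReal (G t)⁻¹ := G.mono.measurable.inv.ennreal_ofReal
  have hmI : Measurable fun t => ENNReal.ofReal (Function.leftLim G t)⁻¹ :=
    G.mono.leftLim.measurable.inv.ennreal_ofReal
  have h := congrArg (fun μ : Measure ℝ =>
    ∫⁻ t in Ico r b, ENNReal.ofReal (Function.leftLim G t)⁻¹ ∂μ) (withDensity_leftLim_negInv G he)
  have hsub : Ico r b ∩ Ioi e = Ico r b := inter_eq_left.2 fun t ht => hr.trans_le ht.1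
  rw [setLIntegral_withDensity_eq_setLIntegral_mul _ hmL hmI measurableSet_Ico,
    setLIntegral_withDensity_eq_setLIntegral_mul _ hmG hmI measurableSet_Ico,
    Measure.restrict_restrict measurableSet_Ico, Measure.restrict_restrict measurableSet_Ico,
    hsub] at h
  have h1 : ∫⁻ t in Ico r b, ENNReal.ofReal (Function.leftLim G t * G t)⁻¹ ∂G.measure =
      ∫⁻ t in Ico r b, ((fun t => ENNReal.ofReal (G t)⁻¹) *
        fun t => ENNReal.ofReal (Function.leftLim G t)⁻¹) t ∂G.measure := by
    refine setLIntegral_congr_fun measurableSet_Ico fun t ht => ?_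
    have hG : 0 < G t := he.trans_le (G.mono (hr.le.trans ht.1))
    rw [Pi.mul_apply, ← ENNReal.ofReal_mul (by positivity), mul_inv, mul_comm]
  have h2 : ∫⁻ t in Ico r b, ((fun t => ENNReal.ofReal (Function.leftLim G t)) *
      fun t => ENNReal.ofReal (Function.leftLim G t)⁻¹) t ∂(negInv G e he).measure =
      ∫⁻ t in Ico r b, 1 ∂(negInv G e he).measure := by
    refine setLIntegral_congr_fun measurableSet_Ico fun t ht => ?_
    have hG := leftLim_pos G he (hr.trans_le ht.1)
    rw [Pi.mul_apply, ← ENNReal.ofReal_mul hG.le, mul_inv_cancel₀ hG.ne', ENNReal.ofReal_one]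
  rw [h1, ← h, h2, setLIntegral_one, StieltjesFunction.measure_Ico, leftLim_negInv G he hr,
    leftLim_negInv G he (hr.trans_le hb)]
  congr 1
  ring

/-- The Stieltjes function replaces `F` by its right limits; left limits survive this, so
`G(t-)G(t)` becomes `F(t-)F(t+)`. -/
theorem leftLim_stieltjesFunction {F : ℝ → ℝ} (hF : Monotone F) (t : ℝ) :
    Function.leftLim hF.stieltjesFunction t = Function.leftLim F t :=
  leftLim_rightLim (hF.tendsto_leftLim t)

theorem extend_pos {γ : ℝ≥0 → ℝ≥0} (hγ_pos : ∀ t : ℝ≥0, 0 < t → 0 < γ t) {t : ℝ} (ht : 0 < t) :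
    0 < extend γ t := NNReal.coe_pos.2 (hγ_pos _ (Real.toNNReal_pos.2 ht))

/-- The `[r, 1)`-mass of `dγ / γ ^ 2`. -/
noncomputable def invMass (γ : ℝ≥0 → ℝ≥0) (hγ : Monotone γ) (r : ℝ) : ℝ≥0∞ :=
  ∫⁻ t in Ico r 1, ENNReal.ofReal
    (Function.leftLim (extend γ) t * Function.rightLim (extend γ) t)⁻¹ ∂(derivMeasure γ hγ)

theorem invMass_eq {γ : ℝ≥0 → ℝ≥0} (hγ : Monotone γ) (hγ_pos : ∀ t : ℝ≥0, 0 < t → 0 < γ t)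
    {r : ℝ} (hr : 0 < r) (hr1 : r ≤ 1) :
    invMass γ hγ r = ENNReal.ofReal
      ((Function.leftLim (extend γ) r)⁻¹ - (Function.leftLim (extend γ) 1)⁻¹) := by
  have hF := extend_monotone hγ
  have he : 0 < hF.stieltjesFunction (r / 2) :=
    (extend_pos hγ_pos (half_pos hr)).trans_le (hF.le_rightLim le_rfl)
  have h := lintegral_Ico_inv_leftLim_mul hF.stieltjesFunction he (half_lt_self hr) hr1
  simp only [leftLim_stieltjesFunction] at h
  exact h

/-- Holds because `γ(r-) ≤ γ(r)`; the additive constant is the endpoint term at `1`. -/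
theorem ofReal_inv_le_add_invMass {γ : ℝ≥0 → ℝ≥0} (hγ : Monotone γ)
    (hγ_pos : ∀ t : ℝ≥0, 0 < t → 0 < γ t) {r : ℝ} (hr : 0 < r) (hr1 : r ≤ 1) :
    ENNReal.ofReal (extend γ r)⁻¹ ≤
      ENNReal.ofReal (Function.leftLim (extend γ) 1)⁻¹ + invMass γ hγ r := by
  have hF := extend_monotone hγ
  have h0 : 0 < Function.leftLim (extend γ) r :=
    (extend_pos hγ_pos (half_pos hr)).trans_le (hF.le_leftLim (half_lt_self hr))
  have h1 : Function.leftLim (extend γ) r ≤ Function.leftLim (extend γ) 1 := hF.leftLim hr1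
  rw [invMass_eq hγ hγ_pos hr hr1, ← ENNReal.ofReal_add (inv_nonneg.2 (h0.le.trans h1))
    (sub_nonneg.2 (inv_anti₀ h0 h1)), add_sub_cancel]
  exact ENNReal.ofReal_le_ofReal (inv_anti₀ h0 (hF.leftLim_le le_rfl))

/-- Here `γ(r/2) ≤ γ(r-)` is used: halving the argument absorbs a possible jump at `r`, at the cost
of a change in the constant `C`. -/
theorem invMass_le {γ : ℝ≥0 → ℝ≥0} (hγ : Monotone γ) (hγ_pos : ∀ t : ℝ≥0, 0 < t → 0 < γ t)
    {r : ℝ} (hr : 0 < r) : invMass γ hγ r ≤ ENNReal.ofReal (extend γ (r / 2))⁻¹ := by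
  rcases le_or_gt r 1 with hr1 | hr1
  · have hF := extend_monotone hγ
    have h0 := extend_pos hγ_pos (half_pos hr)
    have h1 := extend_pos hγ_pos one_half_pos
    have h2 : 0 < Function.leftLim (extend γ) 1 := h1.trans_le (hF.le_leftLim (by norm_num))
    rw [invMass_eq hγ hγ_pos hr hr1]
    refine ENNReal.ofReal_le_ofReal ?_
    have := inv_anti₀ h0 (hF.le_leftLim (half_lt_self hr))
    have h3 : 0 < (Function.leftLim (extend γ) 1)⁻¹ := inv_pos.2 h2
    linarith
  · simp [invMass, Ico_eq_empty_of_le hr1.le]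

/-! ### Averages of the kernel over the segment -/

theorem sq_rpow_neg {l : ℝ} (hl : 0 ≤ l) (r : ℝ) : (l ^ 2) ^ (-r) = l ^ (-(2 * r)) := by
  rw [← Real.rpow_natCast_mul hl]
  congr 1
  push_cast
  ring

/-- One factor of the kernel is the Poisson kernel, of integral `π/l`; the remaining power is at
most `l^(-2s)`. -/
theorem lintegral_kernel_le {s : ℝ} (hs : 0 ≤ s) {l : ℝ} (hl : 0 < l) (t : ℝ) :
    ∫⁻ x : ℝ, ENNReal.ofReal (((x - t) ^ 2 + l ^ 2) ^ (-(1 + s))) ≤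
      ENNReal.ofReal (Real.pi * l ^ (-(2 * s + 1))) := by
  have h1 : ∫ x : ℝ, l * ((x - t) ^ 2 + l ^ 2)⁻¹ = Real.pi := by
    simpa [integral_univ_inv_one_add_sq] using integral_mul_poisson_eq (fun _ => 1) hl t
  have h2 : Integrable fun x : ℝ => l * ((x - t) ^ 2 + l ^ 2)⁻¹ := by
    by_contra hc
    rw [integral_undef hc] at h1
    exact Real.pi_ne_zero h1.symm
  have h3 : ∀ x : ℝ, ((x - t) ^ 2 + l ^ 2) ^ (-(1 + s)) ≤
      l ^ (-(2 * s + 1)) * (l * ((x - t) ^ 2 + l ^ 2)⁻¹) := by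
    intro x
    have h0 : 0 < (x - t) ^ 2 + l ^ 2 := by positivity
    rw [show -(1 + s) = -s + -1 by ring, Real.rpow_add h0, Real.rpow_neg_one, ← mul_assoc]
    gcongr
    calc ((x - t) ^ 2 + l ^ 2) ^ (-s) ≤ (l ^ 2) ^ (-s) :=
          Real.rpow_le_rpow_of_nonpos (by positivity) (by nlinarith [sq_nonneg (x - t)])
            (by linarith)
      _ = l ^ (-(2 * s + 1)) * l := by
          rw [sq_rpow_neg hl.le, show -(2 * s) = -(2 * s + 1) + 1 by ring, Real.rpow_add hl,
            Real.rpow_one]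
  calc ∫⁻ x : ℝ, ENNReal.ofReal (((x - t) ^ 2 + l ^ 2) ^ (-(1 + s)))
      ≤ ∫⁻ x : ℝ, ENNReal.ofReal (l ^ (-(2 * s + 1)) * (l * ((x - t) ^ 2 + l ^ 2)⁻¹)) :=
        lintegral_mono fun x => ENNReal.ofReal_le_ofReal (h3 x)
    _ = _ := by
        rw [← ofReal_integral_eq_lintegral_ofReal (h2.const_mul _)
          (Eventually.of_forall fun x => by positivity), integral_const_mul, h1, mul_comm]

/-- On the side of `t` facing `τ` the segment contains an interval of length `l` whose points lie
within `l` of `t`. There the kernel is at least `(2l²)^(-(1+s))`. -/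
theorem le_lintegral_kernel {s : ℝ} (hs : 0 ≤ s) {l d τ t : ℝ} (hl : 0 < l) (hld : l ≤ d)
    (ht : |t - τ| ≤ d) :
    ENNReal.ofReal (2 ^ (-(1 + s)) * l ^ (-(2 * s + 1))) ≤
      ∫⁻ x in Ioc (τ - d) (τ + d), ENNReal.ofReal (((x - t) ^ 2 + l ^ 2) ^ (-(1 + s))) := by
  obtain ⟨ht1, ht2⟩ := abs_le.1 ht
  have key : ∀ a : ℝ, Ioc a (a + l) ⊆ Ioc (τ - d) (τ + d) → (∀ x ∈ Ioc a (a + l), |x - t| ≤ l) →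
      ENNReal.ofReal (2 ^ (-(1 + s)) * l ^ (-(2 * s + 1))) ≤
      ∫⁻ x in Ioc (τ - d) (τ + d), ENNReal.ofReal (((x - t) ^ 2 + l ^ 2) ^ (-(1 + s))) := by
    intro a hsub hle
    refine le_trans ?_ (lintegral_mono_set hsub)
    have h1 : 2 ^ (-(1 + s)) * l ^ (-(2 * s + 1)) = (2 * l ^ 2) ^ (-(1 + s)) * l := by
      rw [Real.mul_rpow (by norm_num) (by positivity), sq_rpow_neg hl.le, mul_assoc,
        show -(2 * s + 1) = -(2 * (1 + s)) + 1 by ring, Real.rpow_add hl, Real.rpow_one]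
    calc ENNReal.ofReal (2 ^ (-(1 + s)) * l ^ (-(2 * s + 1)))
        = ∫⁻ x in Ioc a (a + l), ENNReal.ofReal ((2 * l ^ 2) ^ (-(1 + s))) := by
          rw [h1, setLIntegral_const, Real.volume_Ioc, add_sub_cancel_left,
            ENNReal.ofReal_mul (by positivity)]
      _ ≤ _ := by
          refine setLIntegral_mono (Measurable.ennreal_ofReal (by fun_prop)) fun x hx =>
            ENNReal.ofReal_le_ofReal ?_
          have : (x - t) ^ 2 ≤ l ^ 2 := sq_le_sq' (by linarith [(abs_le.1 (hle x hx)).1])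
            (abs_le.1 (hle x hx)).2
          exact Real.rpow_le_rpow_of_nonpos (by positivity) (by linarith) (by linarith)
  rcases le_total t τ with h | h
  · refine key t (Ioc_subset_Ioc (by linarith) (by linarith)) fun x hx => ?_
    rw [abs_le]
    constructor <;> linarith [hx.1, hx.2]
  · refine key (t - l) (Ioc_subset_Ioc (by linarith) (by linarith)) fun x hx => ?_
    rw [abs_le]
    constructor <;> linarith [hx.1, hx.2]

/-- When `t` is this distant, `|x - t| ≥ |t - τ|/2` on the whole segment, whatever the height. -/
theorem lintegral_kernel_far_le {s : ℝ} (hs : 0 ≤ s) {d τ t : ℝ} (l : ℝ) (hd : 0 < d)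
    (ht : 2 * d < |t - τ|) :
    ∫⁻ x in Ioc (τ - d) (τ + d), ENNReal.ofReal (((x - t) ^ 2 + l ^ 2) ^ (-(1 + s))) ≤
      ENNReal.ofReal (2 * d * 4 ^ (1 + s)) * ENNReal.ofReal (((t - τ) ^ 2) ^ (-(1 + s))) := by
  have hpos : 0 < (t - τ) ^ 2 := by
    rw [← sq_abs]
    have : 0 < |t - τ| := by linarith
    positivity
  calc ∫⁻ x in Ioc (τ - d) (τ + d), ENNReal.ofReal (((x - t) ^ 2 + l ^ 2) ^ (-(1 + s)))
      ≤ ∫⁻ x in Ioc (τ - d) (τ + d), ENNReal.ofReal (4 ^ (1 + s) * ((t - τ) ^ 2) ^ (-(1 + s))) := by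
        refine setLIntegral_mono measurable_const fun x hx => ENNReal.ofReal_le_ofReal ?_
        have h1 : |x - τ| ≤ d := abs_le.2 ⟨by linarith [hx.1], by linarith [hx.2]⟩
        have h2 : |t - τ| ≤ 2 * |x - t| := by
          have := abs_sub_le t x τ
          rw [abs_sub_comm t x] at this
          linarith
        have h3 : (t - τ) ^ 2 / 4 ≤ (x - t) ^ 2 + l ^ 2 := by
          rw [← sq_abs (t - τ), ← sq_abs (x - t)]
          nlinarith [abs_nonneg (t - τ), sq_nonneg l]
        calc ((x - t) ^ 2 + l ^ 2) ^ (-(1 + s)) ≤ ((t - τ) ^ 2 / 4) ^ (-(1 + s)) :=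
              Real.rpow_le_rpow_of_nonpos (by positivity) h3 (by linarith)
          _ = _ := by
              rw [Real.div_rpow hpos.le (by norm_num), Real.rpow_neg (by norm_num : (0:ℝ) ≤ 4),
                div_inv_eq_mul, mul_comm]
    _ = _ := by
        rw [setLIntegral_const, Real.volume_Ioc, ← ENNReal.ofReal_mul (by positivity),
          ← ENNReal.ofReal_mul (by positivity)]
        congr 1
        ring

/-- Tonelli puts the integral over the segment inside, so that the three kernel estimates apply for
each fixed `t`. -/
theorem ofReal_fracLaplacianAJ {f : ℂ → ℂ} (hf : IsPick f) {s : ℝ} (hs : 0 ≤ s) (τ : ℝ)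
    (lam : ℝ≥0 → ℝ≥0) {d : ℝ≥0} (hl : 0 < lam d) :
    0 ≤ fracLaplacianAJ s f lam τ d ∧ ENNReal.ofReal (fracLaplacianAJ s f lam τ d) =
      ENNReal.ofReal ((2 * (d : ℝ))⁻¹ * (Real.Gamma (1 + s) ^ 2 / Real.pi)) *
        ∫⁻ t, (∫⁻ x in Ioc (τ - d) (τ + d),
          ENNReal.ofReal (((x - t) ^ 2 + (lam d : ℝ) ^ 2) ^ (-(1 + s)))) ∂(nevanlinnaMeasure f) := by
  obtain ⟨hm, hfrac⟩ := hf.fracLaplacian_juliaQuotient s hs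
  have := isLocallyFiniteMeasure_of_integrable hm
  set m := nevanlinnaMeasure f
  have hl' : (0 : ℝ) < lam d := hl
  have hcont := continuous_integral_poisson hm hs hl'
  have hAJ : fracLaplacianAJ s f lam τ d = (2 * (d : ℝ))⁻¹ * (Real.Gamma (1 + s) ^ 2 / Real.pi) *
      ∫ x in Ioc (τ - d) (τ + d), ∫ t, ((x - t) ^ 2 + (lam d : ℝ) ^ 2) ^ (-(1 + s)) ∂m := by
    rw [fracLaplacianAJ, amortize, mul_assoc, ← intervalIntegral.integral_of_le
      (by linarith [d.coe_nonneg]),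
      ← intervalIntegral.integral_const_mul (Real.Gamma (1 + s) ^ 2 / Real.pi)]
    congr 1
    refine intervalIntegral.integral_congr fun x _ => ?_
    rw [hfrac _ (by simpa using hl)]
    simp
  have hnn : ∀ x, 0 ≤ ∫ t, ((x - t) ^ 2 + (lam d : ℝ) ^ 2) ^ (-(1 + s)) ∂m := fun x =>
    integral_nonneg fun t => by positivity
  have hint : IntegrableOn (fun x => ∫ t, ((x - t) ^ 2 + (lam d : ℝ) ^ 2) ^ (-(1 + s)) ∂m)
      (Ioc (τ - d) (τ + d)) := hcont.integrableOn_Icc.mono_set Ioc_subset_Icc_self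
  refine ⟨hAJ ▸ mul_nonneg (by positivity) (integral_nonneg hnn), ?_⟩
  rw [hAJ, ENNReal.ofReal_mul (by positivity), ofReal_integral_eq_lintegral_ofReal hint
    (Eventually.of_forall hnn), lintegral_lintegral_swap
      (Measurable.aemeasurable (by unfold Function.uncurry; fun_prop))]
  congr 1
  refine lintegral_congr fun x => ?_
  rw [ofReal_integral_eq_lintegral_ofReal (integrable_sq_add_sq_rpow hm hs hl' x)
    (Eventually.of_forall fun t => by positivity)]

/-! ### From an augury to regularity -/

/-- The mass of `dγ / γ ^ 2` integrated against a measure of distances. -/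
theorem lintegral_invMass {γ : ℝ≥0 → ℝ≥0} (hγ : Monotone γ) (ρ : Measure ℝ) [SFinite ρ] (τ : ℝ)
    {c : ℝ} (hc : 0 < c) :
    ∫⁻ t, invMass γ hγ (|t - τ| / c) ∂ρ = ∫⁻ u in Ico 0 1, ENNReal.ofReal
      (Function.leftLim (extend γ) u * Function.rightLim (extend γ) u)⁻¹ *
        ρ (Metric.closedBall τ (c * u)) ∂(derivMeasure γ hγ) := by
  have : SFinite (derivMeasure γ hγ) := by
    unfold derivMeasure
    infer_instance
  let w : ℝ → ℝ≥0∞ := fun u => ENNReal.ofReal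
    (Function.leftLim (extend γ) u * Function.rightLim (extend γ) u)⁻¹
  have hw : Measurable w := ((extend_monotone hγ).leftLim.measurable.mul
    (extend_monotone hγ).rightLim.measurable).inv.ennreal_ofReal
  let E : Set (ℝ × ℝ) := {p | |p.1 - τ| ≤ c * p.2}
  have hE : MeasurableSet E := measurableSet_le (by fun_prop) (by fun_prop)
  have h1 : ∀ t, invMass γ hγ (|t - τ| / c) =
      ∫⁻ u in Ico 0 1, E.indicator (fun p => w p.2) (t, u) ∂(derivMeasure γ hγ) := by
    intro t
    rw [invMass, ← lintegral_indicator measurableSet_Ico, ← lintegral_indicator measurableSet_Ico]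
    refine lintegral_congr fun u => ?_
    have h0 : 0 ≤ |t - τ| / c := by positivity
    have hE' : (t, u) ∈ E ↔ |t - τ| / c ≤ u := by
      simp only [E, mem_ofPred_eq]
      rw [div_le_iff₀ hc, mul_comm]
    simp only [indicator, mem_Ico, hE']
    by_cases hu : |t - τ| / c ≤ u
    · simp [hu, h0.trans hu, w]
    · simp [hu]
  simp only [h1]
  rw [lintegral_lintegral_swap (f := fun t u => E.indicator (fun p => w p.2) (t, u))
    ((hw.comp measurable_snd).indicator hE).aemeasurable]
  refine lintegral_congr fun u => ?_
  have h2 : ∀ t, E.indicator (fun p => w p.2) (t, u) =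
      (Metric.closedBall τ (c * u)).indicator (fun _ => w u) t := by
    intro t
    simp only [indicator, E, mem_ofPred_eq, Metric.mem_closedBall, Real.dist_eq]
  simp only [h2]
  rw [lintegral_indicator_const Metric.isClosed_closedBall.measurableSet]

theorem coe_inv_eq_ofReal {γ : ℝ≥0 → ℝ≥0} (hγ_pos : ∀ t : ℝ≥0, 0 < t → 0 < γ t) {r : ℝ≥0}
    (hr : 0 < r) : ((γ r : ℝ≥0) : ℝ≥0∞)⁻¹ = ENNReal.ofReal (extend γ r)⁻¹ := by
  rw [ENNReal.ofReal_inv_of_pos (extend_pos hγ_pos (NNReal.coe_pos.2 hr)), extend, Real.toNNReal_coe,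
    ENNReal.ofReal_coe_nnreal]

/-- Discard all `t` outside the ball and use the lower kernel bound inside it; the prefactor
`1/(2d)` produces the factor `d`. -/
theorem measure_closedBall_le_of_fracLaplacianAJ_le {f : ℂ → ℂ} (hf : IsPick f) {s : ℝ}
    (hs : 0 ≤ s) (τ : ℝ) (lam : ℝ≥0 → ℝ≥0) {d : ℝ≥0} (hd : 0 < d) (hl : 0 < lam d)
    (hld : lam d ≤ d) {M : ℝ} (hM : |fracLaplacianAJ s f lam τ d| ≤ M) :
    nevanlinnaMeasure f (Metric.closedBall τ d) ≤
      ENNReal.ofReal (2 * M / (Real.Gamma (1 + s) ^ 2 / Real.pi * 2 ^ (-(1 + s))) *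
        (d * (lam d ^ (2 * s + 1) : ℝ≥0))) := by
  have hl' : (0 : ℝ) < lam d := hl
  have hd' : (0 : ℝ) < d := hd
  have hΓ : 0 < Real.Gamma (1 + s) := Real.Gamma_pos_of_pos (by linarith)
  have hpi := Real.pi_pos
  obtain ⟨-, hAJ⟩ := ofReal_fracLaplacianAJ hf hs τ lam hl
  set m := nevanlinnaMeasure f
  have h1 : ENNReal.ofReal (2 ^ (-(1 + s)) * (lam d : ℝ) ^ (-(2 * s + 1))) *
      m (Metric.closedBall τ d) ≤ ∫⁻ t, (∫⁻ x in Ioc (τ - d) (τ + d),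
        ENNReal.ofReal (((x - t) ^ 2 + (lam d : ℝ) ^ 2) ^ (-(1 + s)))) ∂m := by
    rw [← lintegral_indicator_const Metric.isClosed_closedBall.measurableSet]
    refine lintegral_mono fun t => ?_
    by_cases ht : t ∈ Metric.closedBall τ d
    · rw [indicator_of_mem ht]
      rw [Metric.mem_closedBall, Real.dist_eq] at ht
      exact le_lintegral_kernel hs hl' (by exact_mod_cast hld) ht
    · rw [indicator_of_notMem ht]
      exact zero_le
  have h2 : ENNReal.ofReal (fracLaplacianAJ s f lam τ d) ≤ ENNReal.ofReal M :=
    ENNReal.ofReal_le_ofReal ((le_abs_self _).trans hM)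
  rw [hAJ] at h2
  have h3 := (mul_le_mul_right h1 _).trans h2
  rw [← mul_assoc, ← ENNReal.ofReal_mul (by positivity)] at h3
  have hA : 0 < (2 * (d : ℝ))⁻¹ * (Real.Gamma (1 + s) ^ 2 / Real.pi) *
      (2 ^ (-(1 + s)) * (lam d : ℝ) ^ (-(2 * s + 1))) := by positivity
  have h4 := (ENNReal.le_div_iff_mul_le (Or.inl (ENNReal.ofReal_pos.2 hA).ne')
    (Or.inl ENNReal.ofReal_ne_top)).2 ((mul_comm _ _).trans_le h3)
  rw [← ENNReal.ofReal_div_of_pos hA] at h4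
  convert h4 using 2
  rw [NNReal.coe_rpow, Real.rpow_neg hl'.le]
  field_simp

theorem measurable_density (γ : ℝ≥0 → ℝ≥0) (hγ : Monotone γ) :
    Measurable fun u => ENNReal.ofReal
      (Function.leftLim (extend γ) u * Function.rightLim (extend γ) u)⁻¹ :=
  ((extend_monotone hγ).leftLim.measurable.mul
    (extend_monotone hγ).rightLim.measurable).inv.ennreal_ofReal

theorem leftLim_mul_rightLim_nonneg (γ : ℝ≥0 → ℝ≥0) (hγ : Monotone γ) (u : ℝ) :
    0 ≤ Function.leftLim (extend γ) u * Function.rightLim (extend γ) u := by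
  have h0 : ∀ v, 0 ≤ extend γ v := fun v => NNReal.coe_nonneg _
  have hF := extend_monotone hγ
  exact mul_nonneg ((h0 (u - 1)).trans (hF.le_leftLim (by linarith)))
    ((h0 u).trans (hF.le_rightLim le_rfl))

/-- An augury that controls the mass of small balls yields regularity. -/
theorem exists_lintegral_inv_lt_top_of_isAugury {γ : ℝ≥0 → ℝ≥0} (hγ : Monotone γ)
    (hγ_pos : ∀ t : ℝ≥0, 0 < t → 0 < γ t) (m : Measure ℝ) [IsLocallyFiniteMeasure m] (τ : ℝ)
    {η : ℝ≥0 → ℝ≥0} (hη : IsAugury γ hγ η) {M : ℝ}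
    (h : ∀ᶠ d : ℝ≥0 in 𝓝[>] 0, m (Metric.closedBall τ d) ≤ ENNReal.ofReal (M * (d * η d))) :
    ∃ C : ℝ≥0, 0 < C ∧ ∃ U ∈ 𝓝 τ, ∫⁻ t in U, ((γ (C * nndist t τ) : ℝ≥0) : ℝ≥0∞)⁻¹ ∂m < ∞ := by
  obtain ⟨hη0, C, hC, hint⟩ := hη
  have hC' : (0 : ℝ) < C := hC
  -- The ball bound is `o(d²)`, so there is no atom at `τ`, the one point where `γ` may vanish.
  have hτ : m {τ} = 0 := by
    have hid : Tendsto (fun d : ℝ≥0 => (d : ℝ)) (𝓝[>] 0) (𝓝 0) :=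
      (NNReal.continuous_coe.tendsto' 0 0 NNReal.coe_zero).mono_left nhdsWithin_le_nhds
    have hlim : Tendsto (fun d : ℝ≥0 => ENNReal.ofReal (M * (d * η d))) (𝓝[>] 0) (𝓝 0) := by
      have := ENNReal.tendsto_ofReal ((hid.mul (hη0.trans_tendsto hid)).const_mul M)
      simpa using this
    refine le_antisymm (ge_of_tendsto hlim ?_) zero_le
    filter_upwards [h] with d hd
    refine le_trans (measure_mono ?_) hd
    simp
  obtain ⟨δ, hδ, hball⟩ : ∃ δ : ℝ≥0, 0 < δ ∧ ∀ d : ℝ≥0, 0 < d → d < δ →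
      m (Metric.closedBall τ d) ≤ ENNReal.ofReal (M * (d * η d)) := by
    obtain ⟨δ, hδ, hsub⟩ := (mem_nhdsGT_iff_exists_Ioo_subset' (zero_lt_one' ℝ≥0)).1 h
    exact ⟨δ, hδ, fun d h0 h1 => hsub ⟨h0, h1⟩⟩
  have hUfin : m (Metric.ball τ C) < ∞ := Metric.isBounded_ball.measure_lt_top
  -- The rescaling matches `η(C u)` with balls of radius `C u`; inside the ball of radius `C` the
  -- quotient `|t - τ|/C` stays below `1`, where `1/γ` is controlled by `invMass`.
  refine ⟨C⁻¹, inv_pos.2 hC, Metric.ball τ C, Metric.ball_mem_nhds τ hC', ?_⟩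
  set w : ℝ → ℝ≥0∞ := fun u => ENNReal.ofReal
    (Function.leftLim (extend γ) u * Function.rightLim (extend γ) u)⁻¹ with hwdef
  have hw : Measurable w := measurable_density γ hγ
  have hae : ∀ᵐ t ∂(m.restrict (Metric.ball τ C)), t ∈ Metric.ball τ C ∧ t ≠ τ := by
    refine (ae_restrict_mem Metric.isOpen_ball.measurableSet).and (ae_restrict_of_ae ?_)
    rw [ae_iff]
    simpa using hτ
  have h1 : ∫⁻ t in Metric.ball τ C, ((γ (C⁻¹ * nndist t τ) : ℝ≥0) : ℝ≥0∞)⁻¹ ∂m ≤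
      ∫⁻ t in Metric.ball τ C, (ENNReal.ofReal (Function.leftLim (extend γ) 1)⁻¹ +
        invMass γ hγ (|t - τ| / C)) ∂m := by
    refine lintegral_mono_ae (hae.mono fun t ht => ?_)
    have hpos : 0 < |t - τ| / C := div_pos (abs_pos.2 (sub_ne_zero.2 ht.2)) hC'
    have hr : ((C⁻¹ * nndist t τ : ℝ≥0) : ℝ) = |t - τ| / C := by
      rw [NNReal.coe_mul, coe_nndist, Real.dist_eq, NNReal.coe_inv, div_eq_inv_mul]
    rw [coe_inv_eq_ofReal hγ_pos (by rw [← NNReal.coe_pos, hr]; exact hpos), hr]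
    refine ofReal_inv_le_add_invMass hγ hγ_pos hpos ?_
    rw [div_le_one hC', ← Real.dist_eq]
    exact (Metric.mem_ball.1 ht.1).le
  refine h1.trans_lt ?_
  rw [lintegral_add_left measurable_const, lintegral_const, Measure.restrict_apply_univ,
    lintegral_invMass hγ _ τ hC']
  refine ENNReal.add_lt_top.2 ⟨ENNReal.mul_lt_top ENNReal.ofReal_lt_top hUfin, ?_⟩
  have hC0 : (C : ℝ) ≠ 0 := hC'.ne'
  have hδ' : (0 : ℝ) < δ := hδ
  -- Below `ε` the ball estimate is valid and the augury integral takes over; above `ε` the measure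
  -- `dγ/γ²` is finite.
  set ε : ℝ := min (δ / C) 1 with hε
  have hε0 : 0 < ε := lt_min (by positivity) one_pos
  have hsub : Ico (0 : ℝ) 1 ⊆ Ico 0 ε ∪ Ico ε 1 := by
    rw [Ico_union_Ico_eq_Ico hε0.le (min_le_right _ _)]
  refine (lintegral_mono_set hsub).trans_lt ((lintegral_union_le _ _ _).trans_lt
    (ENNReal.add_lt_top.2 ⟨?_, ?_⟩))
  · have hfin : ∫⁻ u in Ico 0 1, ENNReal.ofReal (u * (η (C * u.toNNReal) : ℝ) /
        (Function.leftLim (extend γ) u * Function.rightLim (extend γ) u)) ∂(derivMeasure γ hγ) < ∞ :=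
      hint.lintegral_lt_top
    refine lt_of_le_of_lt ?_ (ENNReal.mul_lt_top (ENNReal.ofReal_lt_top (r := M * C)) hfin)
    rw [← lintegral_const_mul' _ _ ENNReal.ofReal_ne_top]
    refine (setLIntegral_mono' measurableSet_Ico fun u hu => ?_).trans
      (lintegral_mono_set (Ico_subset_Ico_right (min_le_right _ _)))
    rcases hu.1.eq_or_lt with rfl | hu0
    · refine le_of_eq_of_le ?_ zero_le
      rw [mul_zero, Metric.closedBall_zero, Measure.restrict_apply (measurableSet_singleton τ),
        measure_mono_null inter_subset_left hτ, mul_zero]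
    · have hcu : ((C * u.toNNReal : ℝ≥0) : ℝ) = C * u := by
        rw [NNReal.coe_mul, Real.coe_toNNReal _ hu.1]
      have hlt : C * u.toNNReal < δ := by
        rw [← NNReal.coe_lt_coe, hcu, mul_comm, ← lt_div_iff₀ hC']
        exact hu.2.trans_le (min_le_left _ _)
      have hb := hball (C * u.toNNReal) (mul_pos hC (Real.toNNReal_pos.2 hu0)) hlt
      rw [hcu] at hb
      have hnn := leftLim_mul_rightLim_nonneg γ hγ u
      calc _ ≤ w u * ENNReal.ofReal (M * (C * u * (η (C * u.toNNReal) : ℝ))) := by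
            gcongr
            exact (Measure.restrict_apply_le _ _).trans hb
        _ = _ := by
            rw [hwdef, ← ENNReal.ofReal_mul (inv_nonneg.2 hnn), ← ENNReal.ofReal_mul' (by positivity)]
            congr 1
            rw [div_eq_mul_inv]
            ring
  · calc _ ≤ ∫⁻ u in Ico ε 1, w u * m (Metric.ball τ C) ∂(derivMeasure γ hγ) := by
          refine lintegral_mono fun u => mul_le_mul_right ?_ _
          exact (measure_mono (subset_univ _)).trans_eq (Measure.restrict_apply_univ _)
      _ = invMass γ hγ ε * m (Metric.ball τ C) := by
          rw [lintegral_mul_const _ hw]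
          rfl
      _ < ∞ := ENNReal.mul_lt_top ((invMass_le hγ hγ_pos hε0).trans_lt ENNReal.ofReal_lt_top) hUfin

/-! ### From regularity to an augury -/

theorem exists_forall_of_eventually_nhdsGT {p : ℝ≥0 → Prop} (h : ∀ᶠ d in 𝓝[>] 0, p d) :
    ∃ δ : ℝ≥0, 0 < δ ∧ ∀ d, 0 < d → d < δ → p d := by
  obtain ⟨δ, hδ, hsub⟩ := (mem_nhdsGT_iff_exists_Ioo_subset' (zero_lt_one' ℝ≥0)).1 h
  exact ⟨δ, hδ, fun d h0 h1 => hsub ⟨h0, h1⟩⟩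

theorem tendsto_coe_nhdsGT_zero : Tendsto (fun d : ℝ≥0 => (d : ℝ)) (𝓝[>] 0) (𝓝 0) :=
  (NNReal.continuous_coe.tendsto' 0 0 NNReal.coe_zero).mono_left nhdsWithin_le_nhds

theorem tendsto_zero_of_isBigO {γ : ℝ≥0 → ℝ≥0} {s : ℝ} (hs : 0 ≤ s)
    (hγ_O : (fun t : ℝ≥0 => (γ t : ℝ)) =O[𝓝[>] 0] (fun t : ℝ≥0 => (t : ℝ) ^ (2 * s + 2))) :
    Tendsto (fun t : ℝ≥0 => (γ t : ℝ)) (𝓝[>] 0) (𝓝 0) := by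
  refine hγ_O.trans_tendsto ?_
  have h := tendsto_coe_nhdsGT_zero.rpow_const (p := 2 * s + 2) (Or.inr (by linarith))
  rwa [Real.zero_rpow (by linarith)] at h

theorem apply_zero_of_isBigO {γ : ℝ≥0 → ℝ≥0} (hγ : Monotone γ) {s : ℝ} (hs : 0 ≤ s)
    (hγ_O : (fun t : ℝ≥0 => (γ t : ℝ)) =O[𝓝[>] 0] (fun t : ℝ≥0 => (t : ℝ) ^ (2 * s + 2))) :
    γ 0 = 0 := by
  have h : (γ 0 : ℝ) ≤ 0 := ge_of_tendsto (tendsto_zero_of_isBigO hs hγ_O)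
    (Eventually.of_forall fun t => NNReal.coe_le_coe.2 (hγ zero_le))
  exact_mod_cast le_antisymm h (NNReal.coe_nonneg _)

/-- Near `τ`, `γ = O(t^(2s+2))` bounds `|t - τ|^(-(2s+2))` by a multiple of `1/γ(C|t - τ|)`; away
from `τ` it is comparable to the kernel at height `ε`, which `m` integrates. -/
theorem lintegral_sq_rpow_lt_top {γ : ℝ≥0 → ℝ≥0}
    (hγ_pos : ∀ t : ℝ≥0, 0 < t → 0 < γ t) {s : ℝ} (hs : 0 ≤ s)
    (hγ_O : (fun t : ℝ≥0 => (γ t : ℝ)) =O[𝓝[>] 0] (fun t : ℝ≥0 => (t : ℝ) ^ (2 * s + 2)))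
    {m : Measure ℝ} (hm : Integrable (fun t : ℝ => (1 + t ^ 2) ^ (-(1 : ℝ))) m) {τ δ : ℝ}
    (hδ : 0 < δ) {C : ℝ≥0} (hC : 0 < C)
    (hreg : ∫⁻ t in Metric.ball τ δ, ((γ (C * nndist t τ) : ℝ≥0) : ℝ≥0∞)⁻¹ ∂m < ∞) :
    ∫⁻ t, ENNReal.ofReal (((t - τ) ^ 2) ^ (-(1 + s))) ∂m < ∞ := by
  obtain ⟨A, hA, hAO⟩ := hγ_O.exists_pos
  obtain ⟨δ₁, hδ₁, hle⟩ := exists_forall_of_eventually_nhdsGT hAO.bound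
  have hC' : (0 : ℝ) < C := hC
  have hδ₁' : (0 : ℝ) < δ₁ := hδ₁
  set ε := min δ (δ₁ / C) with hε
  have hε0 : 0 < ε := lt_min hδ (by positivity)
  rw [← lintegral_add_compl _ (Metric.isOpen_ball (x := τ) (ε := ε)).measurableSet]
  refine ENNReal.add_lt_top.2 ⟨?_, ?_⟩
  · refine lt_of_le_of_lt ?_ (ENNReal.mul_lt_top
      (ENNReal.ofReal_lt_top (r := A * (C : ℝ) ^ (2 * s + 2))) hreg)
    rw [← lintegral_const_mul' _ _ ENNReal.ofReal_ne_top]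
    refine (setLIntegral_mono' Metric.isOpen_ball.measurableSet fun t ht => ?_).trans
      (lintegral_mono_set (Metric.ball_subset_ball (min_le_left _ _)))
    rw [Metric.mem_ball, Real.dist_eq] at ht
    rcases eq_or_ne t τ with rfl | htτ
    · rw [sub_self, zero_pow two_ne_zero, Real.zero_rpow (by linarith), ENNReal.ofReal_zero]
      exact zero_le
    · have hpos : 0 < |t - τ| := abs_pos.2 (sub_ne_zero.2 htτ)
      have hr : ((C * nndist t τ : ℝ≥0) : ℝ) = C * |t - τ| := by
        rw [NNReal.coe_mul, coe_nndist, Real.dist_eq]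
      have hr0 : 0 < C * nndist t τ := by
        rw [← NNReal.coe_pos, hr]
        positivity
      have hr1 : C * nndist t τ < δ₁ := by
        rw [← NNReal.coe_lt_coe, hr, mul_comm, ← lt_div_iff₀ hC']
        exact ht.trans_le (min_le_right _ _)
      have hγle := hle _ hr0 hr1
      have hγ0 : (0 : ℝ) < γ (C * nndist t τ) := hγ_pos _ hr0
      rw [hr, Real.norm_of_nonneg hγ0.le, Real.norm_of_nonneg (by positivity),
        Real.mul_rpow hC'.le hpos.le] at hγle
      rw [← ENNReal.ofReal_coe_nnreal, ← ENNReal.ofReal_inv_of_pos hγ0,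
        ← ENNReal.ofReal_mul (by positivity)]
      refine ENNReal.ofReal_le_ofReal ?_
      rw [← sq_abs, sq_rpow_neg hpos.le, Real.rpow_neg hpos.le, ← div_eq_mul_inv,
        le_div_iff₀ hγ0, inv_mul_le_iff₀ (by positivity), show 2 * (1 + s) = 2 * s + 2 by ring]
      linarith
  · have hint := (integrable_sq_add_sq_rpow hm hs hε0 τ).const_mul (2 ^ (1 + s))
    refine lt_of_le_of_lt ?_ hint.lintegral_lt_top
    refine (setLIntegral_mono' Metric.isOpen_ball.measurableSet.compl fun t ht =>
      ENNReal.ofReal_le_ofReal ?_).trans (setLIntegral_le_lintegral _ _)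
    rw [mem_compl_iff, Metric.mem_ball, Real.dist_eq, not_lt] at ht
    have h1 : ε ^ 2 ≤ (t - τ) ^ 2 := by
      rw [← sq_abs (t - τ)]
      gcongr
    have h2 : ((τ - t) ^ 2 + ε ^ 2) / 2 ≤ (t - τ) ^ 2 := by nlinarith
    calc ((t - τ) ^ 2) ^ (-(1 + s)) ≤ (((τ - t) ^ 2 + ε ^ 2) / 2) ^ (-(1 + s)) :=
          Real.rpow_le_rpow_of_nonpos (by positivity) h2 (by linarith)
      _ = _ := by
          rw [Real.div_rpow (by positivity) (by norm_num), Real.rpow_neg (by norm_num : (0 : ℝ) ≤ 2),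
            div_inv_eq_mul, mul_comm]

theorem tendsto_setLIntegral_closedBall {m : Measure ℝ} {g : ℝ → ℝ≥0∞} (τ : ℝ) (hτ : m {τ} = 0)
    (hg : ∫⁻ t, g t ∂m < ∞) [IsLocallyFiniteMeasure m] :
    Tendsto (fun d : ℝ≥0 => ∫⁻ t in Metric.closedBall τ (2 * d), g t ∂m) (𝓝[>] 0) (𝓝 0) := by
  refine tendsto_setLIntegral_zero hg.ne ?_
  have h1 : Tendsto (fun d : ℝ≥0 => m (Metric.closedBall τ (2 * d))) (𝓝[>] 0)
      (𝓝 (m (⋂ d > (0 : ℝ≥0), Metric.closedBall τ (2 * d)))) := by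
    refine tendsto_measure_biInter_gt
      (fun d _ => Metric.isClosed_closedBall.measurableSet.nullMeasurableSet)
      (fun i j _ hij => Metric.closedBall_subset_closedBall (by gcongr)) ⟨1, one_pos, ?_⟩
    exact Metric.isBounded_closedBall.measure_lt_top.ne
  have h2 : (⋂ d > (0 : ℝ≥0), Metric.closedBall τ (2 * (d : ℝ))) = {τ} := by
    refine subset_antisymm (fun t ht => ?_) ?_
    · simp only [mem_iInter, Metric.mem_closedBall] at ht
      rw [mem_singleton_iff]
      by_contra hne
      have hpos : 0 < nndist t τ := by
        rw [← NNReal.coe_pos, coe_nndist]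
        exact dist_pos.2 hne
      have := ht (nndist t τ / 4) (by positivity)
      rw [NNReal.coe_div, coe_nndist] at this
      have h0 : 0 < dist t τ := dist_pos.2 hne
      norm_num at this
      linarith
    · simp
  rwa [h2, hτ] at h1

/-- Chebyshev's inequality: on the ball the integrand is at least `(2d)^(-(2s+2))` off `τ`, and its
integral over shrinking balls tends to `0`. -/
theorem measure_closedBall_isLittleO {m : Measure ℝ} [IsLocallyFiniteMeasure m] {τ s : ℝ}
    (hs : 0 ≤ s) (hτ : m {τ} = 0)
    (hJ : ∫⁻ t, ENNReal.ofReal (((t - τ) ^ 2) ^ (-(1 + s))) ∂m < ∞) :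
    (fun d : ℝ≥0 => (m (Metric.closedBall τ (2 * d))).toReal) =o[𝓝[>] 0]
      (fun d : ℝ≥0 => (d : ℝ) ^ (2 * s + 2)) := by
  have hlim := tendsto_setLIntegral_closedBall τ hτ hJ
  have hlim' := (ENNReal.tendsto_toReal ENNReal.zero_ne_top).comp hlim
  rw [ENNReal.toReal_zero] at hlim'
  have hprod : (fun d : ℝ≥0 => (2 ^ (2 * s + 2) * ((∫⁻ t in Metric.closedBall τ (2 * d),
      ENNReal.ofReal (((t - τ) ^ 2) ^ (-(1 + s))) ∂m).toReal)) * (d : ℝ) ^ (2 * s + 2)) =o[𝓝[>] 0]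
      (fun d : ℝ≥0 => (d : ℝ) ^ (2 * s + 2)) := by
    have h1 := (isLittleO_one_iff ℝ).2 (by simpa using hlim'.const_mul (2 ^ (2 * s + 2)))
    simpa using h1.mul_isBigO (isBigO_refl (fun d : ℝ≥0 => (d : ℝ) ^ (2 * s + 2)) (𝓝[>] 0))
  refine (IsBigO.of_bound 1 ?_).trans_isLittleO hprod
  filter_upwards [self_mem_nhdsWithin] with d (hd : 0 < d)
  have hd' : (0 : ℝ) < d := hd
  rw [one_mul, Real.norm_of_nonneg ENNReal.toReal_nonneg, Real.norm_of_nonneg (by positivity)]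
  have hfin : ∫⁻ t in Metric.closedBall τ (2 * d),
      ENNReal.ofReal (((t - τ) ^ 2) ^ (-(1 + s))) ∂m ≠ ∞ :=
    ((setLIntegral_le_lintegral _ _).trans_lt hJ).ne
  have hkey : ENNReal.ofReal ((2 * (d : ℝ)) ^ (-(2 * s + 2))) * m (Metric.closedBall τ (2 * d)) ≤
      ∫⁻ t in Metric.closedBall τ (2 * d), ENNReal.ofReal (((t - τ) ^ 2) ^ (-(1 + s))) ∂m := by
    rw [← setLIntegral_const]
    refine lintegral_mono_ae ?_
    have hae : ∀ᵐ t ∂(m.restrict (Metric.closedBall τ (2 * d))),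
        t ∈ Metric.closedBall τ (2 * d) ∧ t ≠ τ := by
      refine (ae_restrict_mem Metric.isClosed_closedBall.measurableSet).and (ae_restrict_of_ae ?_)
      rw [ae_iff]
      simpa using hτ
    refine hae.mono fun t ht => ENNReal.ofReal_le_ofReal ?_
    have h1 : |t - τ| ≤ 2 * d := ht.1
    have h0 : 0 < |t - τ| := abs_pos.2 (sub_ne_zero.2 ht.2)
    rw [← sq_abs, sq_rpow_neg h0.le, show 2 * (1 + s) = 2 * s + 2 by ring]
    exact Real.rpow_le_rpow_of_nonpos h0 h1 (by linarith)
  have hkey' := ENNReal.toReal_mono hfin hkey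
  rw [ENNReal.toReal_mul, ENNReal.toReal_ofReal (by positivity), Real.rpow_neg (by positivity),
    inv_mul_le_iff₀ (by positivity), Real.mul_rpow (by norm_num) hd'.le] at hkey'
  linarith

/-- The mass of a closed ball, made positive by adding a small multiple of `γ ^ 2`. -/
noncomputable def ballMass (ρ : Measure ℝ) (γ : ℝ≥0 → ℝ≥0) (τ : ℝ) (C d : ℝ≥0) : ℝ≥0 :=
  (ρ (Metric.closedBall τ (2 * d))).toNNReal + γ (2 * C * d) ^ 2

theorem ballMass_monotone (ρ : Measure ℝ) [IsFiniteMeasure ρ] {γ : ℝ≥0 → ℝ≥0} (hγ : Monotone γ)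
    (τ : ℝ) (C : ℝ≥0) : Monotone (ballMass ρ γ τ C) := by
  intro a b hab
  unfold ballMass
  gcongr
  · exact measure_ne_top _ _
  · exact hγ (by gcongr)

theorem ballMass_pos (ρ : Measure ℝ) {γ : ℝ≥0 → ℝ≥0} (hγ_pos : ∀ t : ℝ≥0, 0 < t → 0 < γ t)
    (τ : ℝ) {C d : ℝ≥0} (hC : 0 < C) (hd : 0 < d) : 0 < ballMass ρ γ τ C d :=
  add_pos_of_nonneg_of_pos zero_le (pow_pos (hγ_pos _ (by positivity)) 2)

theorem ballMass_isLittleO {ρ : Measure ℝ} [IsFiniteMeasure ρ] {γ : ℝ≥0 → ℝ≥0} {τ s : ℝ}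
    (hs : 0 ≤ s) (hτ : ρ {τ} = 0)
    (hJ : ∫⁻ t, ENNReal.ofReal (((t - τ) ^ 2) ^ (-(1 + s))) ∂ρ < ∞)
    (hγ_O : (fun t : ℝ≥0 => (γ t : ℝ)) =O[𝓝[>] 0] (fun t : ℝ≥0 => (t : ℝ) ^ (2 * s + 2)))
    {C : ℝ≥0} (hC : 0 < C) :
    (fun d : ℝ≥0 => (ballMass ρ γ τ C d : ℝ)) =o[𝓝[>] 0] (fun d : ℝ≥0 => (d : ℝ) ^ (2 * s + 2)) := by
  have hmap : Tendsto (fun d : ℝ≥0 => 2 * C * d) (𝓝[>] 0) (𝓝[>] 0) := by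
    refine tendsto_nhdsWithin_iff.2 ⟨?_, ?_⟩
    · have : Continuous fun d : ℝ≥0 => 2 * C * d := by fun_prop
      exact (this.tendsto' 0 0 (mul_zero _)).mono_left nhdsWithin_le_nhds
    · filter_upwards [self_mem_nhdsWithin] with d (hd : 0 < d)
      exact mul_pos (by positivity) hd
  have h1 : (fun d : ℝ≥0 => (γ (2 * C * d) : ℝ)) =O[𝓝[>] 0]
      (fun d : ℝ≥0 => (d : ℝ) ^ (2 * s + 2)) := by
    refine (hγ_O.comp_tendsto hmap).trans (IsBigO.of_bound ((2 * C : ℝ) ^ (2 * s + 2)) ?_)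
    refine Eventually.of_forall fun d => ?_
    rw [Function.comp_apply, NNReal.coe_mul, Real.mul_rpow (by positivity) d.coe_nonneg, norm_mul]
    gcongr
    rw [Real.norm_of_nonneg (by positivity)]
    simp
  have h2 : (fun d : ℝ≥0 => (γ (2 * C * d) : ℝ)) =o[𝓝[>] 0] (fun _ : ℝ≥0 => (1 : ℝ)) :=
    (isLittleO_one_iff ℝ).2 ((tendsto_zero_of_isBigO hs hγ_O).comp hmap)
  have h3 : (fun d : ℝ≥0 => (γ (2 * C * d) : ℝ) ^ 2) =o[𝓝[>] 0]
      (fun d : ℝ≥0 => (d : ℝ) ^ (2 * s + 2)) := by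
    simpa [sq] using h2.mul_isBigO h1
  refine ((measure_closedBall_isLittleO hs hτ hJ).add h3).congr_left fun d => ?_
  simp [ballMass, ENNReal.toReal]

theorem div_isLittleO {N : ℝ≥0 → ℝ≥0} {s : ℝ}
    (hN : (fun d : ℝ≥0 => (N d : ℝ)) =o[𝓝[>] 0] (fun d : ℝ≥0 => (d : ℝ) ^ (2 * s + 2))) :
    (fun d : ℝ≥0 => ((N d / d : ℝ≥0) : ℝ)) =o[𝓝[>] 0] (fun d : ℝ≥0 => (d : ℝ) ^ (2 * s + 1)) := by
  have h := hN.mul_isBigO (isBigO_refl (fun d : ℝ≥0 => (d : ℝ)⁻¹) (𝓝[>] 0))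
  refine h.congr' (Eventually.of_forall fun d => ?_) ?_
  · simp [div_eq_mul_inv]
  · filter_upwards [self_mem_nhdsWithin] with d (hd : 0 < d)
    have hd' : (0 : ℝ) < d := hd
    rw [show 2 * s + 2 = (2 * s + 1) + 1 by ring, Real.rpow_add hd', Real.rpow_one, mul_assoc,
      mul_inv_cancel₀ hd'.ne', mul_one]

/-- At `d = u/(4C)` the ball has radius `u/(2C)`, and its contribution is the integral of `invMass`
at `2C|t - τ|`, at most `1/γ(C|t - τ|)`. The added term is `γ(u/2)²`, below `γ(u-)γ(u+)`, so it
costs only the finite `dγ`-mass of `[0, 1)`. -/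
theorem isAugury_ballMass_div {γ : ℝ≥0 → ℝ≥0} (hγ : Monotone γ)
    (hγ_pos : ∀ t : ℝ≥0, 0 < t → 0 < γ t) {ρ : Measure ℝ} [IsFiniteMeasure ρ] {τ s : ℝ}
    (hs : 0 ≤ s) (hτ : ρ {τ} = 0) {C : ℝ≥0} (hC : 0 < C)
    (hreg : ∫⁻ t, ((γ (C * nndist t τ) : ℝ≥0) : ℝ≥0∞)⁻¹ ∂ρ < ∞)
    (hN : (fun d : ℝ≥0 => (ballMass ρ γ τ C d : ℝ)) =o[𝓝[>] 0]
      (fun d : ℝ≥0 => (d : ℝ) ^ (2 * s + 2))) :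
    IsAugury γ hγ fun d => ballMass ρ γ τ C d / d := by
  have hC' : (0 : ℝ) < C := hC
  refine ⟨(div_isLittleO hN).trans_isBigO (IsBigO.of_bound 1 ?_), (4 * C)⁻¹, by positivity, ?_, ?_⟩
  · filter_upwards [Ioo_mem_nhdsGT (zero_lt_one' ℝ≥0)] with d hd
    have h0 : (0 : ℝ) < d := hd.1
    have h1 : (d : ℝ) < 1 := hd.2
    rw [one_mul, Real.norm_of_nonneg (by positivity), Real.norm_of_nonneg h0.le]
    calc (d : ℝ) ^ (2 * s + 1) ≤ (d : ℝ) ^ (1 : ℝ) :=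
          Real.rpow_le_rpow_of_exponent_ge h0 h1.le (by linarith)
      _ = d := Real.rpow_one _
  · have h1 : Measurable (ballMass ρ γ τ C) := (ballMass_monotone ρ hγ τ C).measurable
    have h2 := (extend_monotone hγ).leftLim.measurable
    have h3 := (extend_monotone hγ).rightLim.measurable
    exact Measurable.aestronglyMeasurable (by fun_prop)
  rw [hasFiniteIntegral_iff_ofReal ?_]
  swap
  · filter_upwards [ae_restrict_mem measurableSet_Ico] with u hu
    exact div_nonneg (mul_nonneg hu.1 (NNReal.coe_nonneg _)) (leftLim_mul_rightLim_nonneg γ hγ u)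
  have hw := measurable_density γ hγ
  set w : ℝ → ℝ≥0∞ := fun u => ENNReal.ofReal
    (Function.leftLim (extend γ) u * Function.rightLim (extend γ) u)⁻¹ with hwdef
  have hbound : ∀ u ∈ Ico (0 : ℝ) 1, ENNReal.ofReal
      (u * ((ballMass ρ γ τ C ((4 * C)⁻¹ * u.toNNReal) / ((4 * C)⁻¹ * u.toNNReal) : ℝ≥0) : ℝ) /
        (Function.leftLim (extend γ) u * Function.rightLim (extend γ) u)) ≤
      ENNReal.ofReal (4 * C) * (w u * ρ (Metric.closedBall τ ((2 * (C : ℝ))⁻¹ * u)) + 1) := by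
    intro u hu
    rcases hu.1.eq_or_lt with rfl | hu0
    · simp
    have hF := extend_monotone hγ
    have hnn := leftLim_mul_rightLim_nonneg γ hγ u
    have hg0 := extend_pos hγ_pos (half_pos hu0)
    have hgL := hF.le_leftLim (half_lt_self hu0)
    have hgR : extend γ (u / 2) ≤ Function.rightLim (extend γ) u :=
      hgL.trans (hF.leftLim_le_rightLim le_rfl)
    have hone : w u * ENNReal.ofReal (extend γ (u / 2) ^ 2) ≤ 1 := by
      rw [hwdef, ← ENNReal.ofReal_mul (inv_nonneg.2 hnn), ← ENNReal.ofReal_one]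
      refine ENNReal.ofReal_le_ofReal ?_
      rw [inv_mul_le_iff₀ (mul_pos (hg0.trans_le hgL) (hg0.trans_le hgR)), mul_one, sq]
      exact mul_le_mul hgL hgR hg0.le (hg0.le.trans hgL)
    have harg : 2 * C * ((4 * C)⁻¹ * u.toNNReal) = (u / 2).toNNReal := by
      rw [← NNReal.coe_inj]
      push_cast
      rw [Real.coe_toNNReal _ hu0.le, Real.coe_toNNReal _ (by positivity)]
      field_simp
      norm_num
    have hrad : 2 * (((4 * C)⁻¹ * u.toNNReal : ℝ≥0) : ℝ) = (2 * (C : ℝ))⁻¹ * u := by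
      push_cast
      rw [Real.coe_toNNReal _ hu0.le]
      field_simp
      norm_num
    have hmass : ENNReal.ofReal (ballMass ρ γ τ C ((4 * C)⁻¹ * u.toNNReal) : ℝ) =
        ρ (Metric.closedBall τ ((2 * (C : ℝ))⁻¹ * u)) + ENNReal.ofReal (extend γ (u / 2) ^ 2) := by
      rw [ENNReal.ofReal_coe_nnreal, ballMass, harg, hrad, ENNReal.coe_add,
        ENNReal.coe_toNNReal (measure_ne_top _ _), extend, ← NNReal.coe_pow,
        ENNReal.ofReal_coe_nnreal]
    have heq : u * ((ballMass ρ γ τ C ((4 * C)⁻¹ * u.toNNReal) / ((4 * C)⁻¹ * u.toNNReal) : ℝ≥0) : ℝ) /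
        (Function.leftLim (extend γ) u * Function.rightLim (extend γ) u) =
        4 * C * ((Function.leftLim (extend γ) u * Function.rightLim (extend γ) u)⁻¹ *
          (ballMass ρ γ τ C ((4 * C)⁻¹ * u.toNNReal) : ℝ)) := by
      push_cast
      rw [Real.coe_toNNReal _ hu0.le]
      field_simp
    rw [heq, ENNReal.ofReal_mul (by positivity), ENNReal.ofReal_mul (inv_nonneg.2 hnn), hmass,
      mul_add]
    gcongr
  refine (setLIntegral_mono' measurableSet_Ico hbound).trans_lt ?_
  rw [lintegral_const_mul' _ _ ENNReal.ofReal_ne_top, lintegral_add_right _ measurable_const,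
    setLIntegral_one, ← lintegral_invMass hγ ρ τ (by positivity)]
  refine ENNReal.mul_lt_top ENNReal.ofReal_lt_top (ENNReal.add_lt_top.2 ⟨?_, ?_⟩)
  · refine lt_of_le_of_lt (lintegral_mono_ae ?_) hreg
    have hae : ∀ᵐ t ∂ρ, t ≠ τ := by
      rw [ae_iff]
      simpa using hτ
    refine hae.mono fun t ht => ?_
    have h0 : 0 < |t - τ| := abs_pos.2 (sub_ne_zero.2 ht)
    have hr : ((C * nndist t τ : ℝ≥0) : ℝ) = C * |t - τ| := by
      rw [NNReal.coe_mul, coe_nndist, Real.dist_eq]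
    rw [coe_inv_eq_ofReal hγ_pos (by rw [← NNReal.coe_pos, hr]; positivity), hr]
    refine (invMass_le hγ hγ_pos (by positivity)).trans_eq ?_
    congr 3
    field_simp
  · rw [derivMeasure, StieltjesFunction.measure_Ico]
    exact ENNReal.ofReal_lt_top

theorem rpow_inv_isLittleO {η : ℝ≥0 → ℝ≥0} {q : ℝ} (hq : 0 < q)
    (hη : (fun d : ℝ≥0 => (η d : ℝ)) =o[𝓝[>] 0] (fun d : ℝ≥0 => (d : ℝ) ^ q)) :
    (fun d : ℝ≥0 => ((η d ^ q⁻¹ : ℝ≥0) : ℝ)) =o[𝓝[>] 0] (fun d : ℝ≥0 => (d : ℝ)) := by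
  refine IsLittleO.of_bound fun c hc => ?_
  filter_upwards [hη.bound (show 0 < c ^ q by positivity)] with d hd
  rw [Real.norm_of_nonneg (NNReal.coe_nonneg _), Real.norm_of_nonneg (by positivity),
    ← Real.mul_rpow hc.le d.coe_nonneg] at hd
  rw [Real.norm_of_nonneg (NNReal.coe_nonneg _), Real.norm_of_nonneg (NNReal.coe_nonneg _),
    NNReal.coe_rpow]
  exact (Real.rpow_inv_le_iff_of_pos (NNReal.coe_nonneg _) (by positivity) hq).2 hd

/-- Split at distance `2d`. The near part is the ball mass times `π λ(d)^(-(2s+1))`, at most `π d`;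
the far part is at most a constant times `d` times the singular integral. The prefactor `1/(2d)`
cancels both factors `d`. -/
theorem fracLaplacianAJ_le {f : ℂ → ℂ} (hf : IsPick f) {s : ℝ} (hs : 0 ≤ s) (τ : ℝ)
    (lam : ℝ≥0 → ℝ≥0) {d : ℝ≥0} (hd : 0 < d) (hl : 0 < lam d)
    (hJ : ∫⁻ t, ENNReal.ofReal (((t - τ) ^ 2) ^ (-(1 + s))) ∂(nevanlinnaMeasure f) < ∞)
    (hball : nevanlinnaMeasure f (Metric.closedBall τ (2 * d)) ≤
      ENNReal.ofReal ((lam d : ℝ) ^ (2 * s + 1) * d)) :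
    |fracLaplacianAJ s f lam τ d| ≤ Real.Gamma (1 + s) ^ 2 / Real.pi / 2 * (Real.pi + 2 * 4 ^ (1 + s) *
      (∫⁻ t, ENNReal.ofReal (((t - τ) ^ 2) ^ (-(1 + s))) ∂(nevanlinnaMeasure f)).toReal) := by
  obtain ⟨hnn, hAJ⟩ := ofReal_fracLaplacianAJ hf hs τ lam hl
  set m := nevanlinnaMeasure f
  set J := ∫⁻ t, ENNReal.ofReal (((t - τ) ^ 2) ^ (-(1 + s))) ∂m with hJdef
  have hl' : (0 : ℝ) < lam d := hl
  have hd' : (0 : ℝ) < d := hd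
  have hpi := Real.pi_pos
  have hJ0 : 0 ≤ J.toReal := ENNReal.toReal_nonneg
  rw [abs_of_nonneg hnn, ← ENNReal.ofReal_le_ofReal_iff (by positivity), hAJ]
  have hnear : ∫⁻ t in Metric.closedBall τ (2 * d), (∫⁻ x in Ioc (τ - d) (τ + d),
      ENNReal.ofReal (((x - t) ^ 2 + (lam d : ℝ) ^ 2) ^ (-(1 + s)))) ∂m ≤
      ENNReal.ofReal (Real.pi * d) := by
    calc _ ≤ ∫⁻ t in Metric.closedBall τ (2 * d),
          ENNReal.ofReal (Real.pi * (lam d : ℝ) ^ (-(2 * s + 1))) ∂m :=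
          lintegral_mono fun t => (setLIntegral_le_lintegral _ _).trans (lintegral_kernel_le hs hl' t)
      _ ≤ ENNReal.ofReal (Real.pi * (lam d : ℝ) ^ (-(2 * s + 1))) *
          ENNReal.ofReal ((lam d : ℝ) ^ (2 * s + 1) * d) := by
          rw [setLIntegral_const]
          gcongr
      _ = _ := by
          rw [← ENNReal.ofReal_mul (by positivity), Real.rpow_neg hl'.le]
          congr 1
          field_simp
  have hfar : ∫⁻ t in (Metric.closedBall τ (2 * d))ᶜ, (∫⁻ x in Ioc (τ - d) (τ + d),
      ENNReal.ofReal (((x - t) ^ 2 + (lam d : ℝ) ^ 2) ^ (-(1 + s)))) ∂m ≤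
      ENNReal.ofReal (2 * d * 4 ^ (1 + s) * J.toReal) := by
    calc _ ≤ ∫⁻ t in (Metric.closedBall τ (2 * d))ᶜ, ENNReal.ofReal (2 * d * 4 ^ (1 + s)) *
          ENNReal.ofReal (((t - τ) ^ 2) ^ (-(1 + s))) ∂m := by
          refine setLIntegral_mono' Metric.isClosed_closedBall.measurableSet.compl fun t ht => ?_
          rw [mem_compl_iff, Metric.mem_closedBall, Real.dist_eq, not_le] at ht
          exact lintegral_kernel_far_le hs _ hd' ht
      _ ≤ ENNReal.ofReal (2 * d * 4 ^ (1 + s)) * J := by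
          rw [lintegral_const_mul' _ _ ENNReal.ofReal_ne_top]
          gcongr
          exact setLIntegral_le_lintegral _ _
      _ = _ := by rw [ENNReal.ofReal_mul (q := J.toReal) (by positivity), ENNReal.ofReal_toReal hJ.ne]
  rw [← lintegral_add_compl _
    (Metric.isClosed_closedBall (x := τ) (ε := 2 * (d : ℝ))).measurableSet]
  refine (mul_le_mul_right (add_le_add hnear hfar) _).trans_eq ?_
  rw [← ENNReal.ofReal_add (by positivity) (by positivity), ← ENNReal.ofReal_mul (by positivity)]
  congr 1
  field_simp

end Pick

theorem mainTheorem6 (s : ℝ) (hs : 0 ≤ s)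
    (γ : ℝ≥0 → ℝ≥0) (hγ : Monotone γ) (hγ_pos : ∀ t : ℝ≥0, 0 < t → 0 < γ t)
    (hγ_O : (fun t : ℝ≥0 => (γ t : ℝ)) =O[𝓝[>] 0] (fun t : ℝ≥0 => (t : ℝ) ^ (2 * s + 2)))
    (f : ℂ → ℂ) (hf : Pick.IsPick f) (τ : ℝ) :
    Pick.IsRegular γ f τ ↔
      ∃ lam : ℝ≥0 → ℝ≥0,
        (∀ᶠ t : ℝ≥0 in 𝓝[>] 0, 0 < lam t) ∧
        (fun t : ℝ≥0 => (lam t : ℝ)) =o[𝓝[>] 0] (fun t : ℝ≥0 => (t : ℝ)) ∧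
        Pick.IsAugury γ hγ (fun t => lam t ^ (2 * s + 1)) ∧
        ∃ M : ℝ, ∀ᶠ d : ℝ≥0 in 𝓝[>] 0, |Pick.fracLaplacianAJ s f lam τ d| ≤ M := by
  have hm := (hf.fracLaplacian_juliaQuotient s hs).1
  have hloc := Pick.isLocallyFiniteMeasure_of_integrable hm
  constructor
  · rintro ⟨C, hC, U, hU, hreg⟩
    obtain ⟨δ, hδ, hsub⟩ := Metric.mem_nhds_iff.1 hU
    have hreg' := (lintegral_mono_set (μ := Pick.nevanlinnaMeasure f) hsub).trans_lt hreg
    have hτ : Pick.nevanlinnaMeasure f {τ} = 0 := by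
      have h := (lintegral_mono_set (singleton_subset_iff.2 (Metric.mem_ball_self hδ))).trans_lt hreg'
      by_contra hne
      rw [lintegral_singleton, nndist_self, mul_zero, Pick.apply_zero_of_isBigO hγ hs hγ_O,
        ENNReal.coe_zero, ENNReal.inv_zero, ENNReal.top_mul hne] at h
      exact lt_irrefl _ h
    have hJ := Pick.lintegral_sq_rpow_lt_top hγ_pos hs hγ_O hm hδ hC hreg'
    -- Restricting to a ball makes the measure finite and the regularity integral global.
    set ρ := (Pick.nevanlinnaMeasure f).restrict (Metric.ball τ δ) with hρ
    have hρfin : IsFiniteMeasure ρ :=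
      ⟨by rw [hρ, Measure.restrict_apply_univ]; exact Metric.isBounded_ball.measure_lt_top⟩
    have hρτ : ρ {τ} = 0 := le_antisymm ((Measure.restrict_apply_le _ _).trans_eq hτ) zero_le
    have hN := Pick.ballMass_isLittleO hs hρτ
      ((setLIntegral_le_lintegral _ _).trans_lt hJ) hγ_O hC
    have hq : 0 < 2 * s + 1 := by linarith
    have hpow : ∀ t : ℝ≥0, ((Pick.ballMass ρ γ τ C t / t) ^ (2 * s + 1)⁻¹) ^ (2 * s + 1) =
        Pick.ballMass ρ γ τ C t / t := fun t => NNReal.rpow_inv_rpow hq.ne' _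
    refine ⟨fun d => (Pick.ballMass ρ γ τ C d / d) ^ (2 * s + 1)⁻¹, ?_,
      Pick.rpow_inv_isLittleO hq (Pick.div_isLittleO hN), ?_,
      Real.Gamma (1 + s) ^ 2 / Real.pi / 2 * (Real.pi + 2 * 4 ^ (1 + s) * (∫⁻ t, ENNReal.ofReal
        (((t - τ) ^ 2) ^ (-(1 + s))) ∂(Pick.nevanlinnaMeasure f)).toReal), ?_⟩
    · filter_upwards [self_mem_nhdsWithin] with d (hd : 0 < d)
      exact NNReal.rpow_pos (div_pos (Pick.ballMass_pos ρ hγ_pos τ hC hd) hd)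
    · simp only [hpow]
      exact Pick.isAugury_ballMass_div hγ hγ_pos hs hρτ hC hreg' hN
    -- Once `d < δ/2`, the ball of radius `2d` lies inside `B(τ, δ)`, so `ρ` and the full measure
    -- agree on it.
    · have hδ2 : (0 : ℝ≥0) < (δ / 2).toNNReal := Real.toNNReal_pos.2 (half_pos hδ)
      filter_upwards [Ioo_mem_nhdsGT hδ2] with d hd
      have hd0 : (0 : ℝ≥0) < d := hd.1
      have hdδ : (d : ℝ) < δ / 2 := by
        have := NNReal.coe_lt_coe.2 hd.2
        rwa [Real.coe_toNNReal _ (half_pos hδ).le] at this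
      refine Pick.fracLaplacianAJ_le hf hs τ _ hd0
        (NNReal.rpow_pos (div_pos (Pick.ballMass_pos ρ hγ_pos τ hC hd0) hd0)) hJ ?_
      rw [← NNReal.coe_rpow, hpow, ← NNReal.coe_mul, div_mul_cancel₀ _ hd0.ne',
        ENNReal.ofReal_coe_nnreal, Pick.ballMass, ENNReal.coe_add,
        ENNReal.coe_toNNReal (measure_ne_top _ _), hρ,
        Measure.restrict_apply Metric.isClosed_closedBall.measurableSet, inter_eq_left.2
          (Metric.closedBall_subset_ball (by linarith))]
      exact le_self_add
  · rintro ⟨lam, hpos, hlo, haug, M, hM⟩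
    refine Pick.exists_lintegral_inv_lt_top_of_isAugury hγ hγ_pos _ τ haug
      (M := 2 * M / (Real.Gamma (1 + s) ^ 2 / Real.pi * 2 ^ (-(1 + s)))) ?_
    -- From `λ(t) = o(t)` only `λ(d) ≤ d` is needed: the segment must be wide enough for the lower
    -- kernel bound.
    filter_upwards [hpos, hlo.bound one_pos, hM, self_mem_nhdsWithin] with d h1 h2 h3 (h4 : 0 < d)
    rw [one_mul, Real.norm_of_nonneg (NNReal.coe_nonneg _),
      Real.norm_of_nonneg (NNReal.coe_nonneg _)] at h2
    exact Pick.measure_closedBall_le_of_fracLaplacianAJ_le hf hs τ lam h4 h1 (by exact_mod_cast h2) h3
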